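/- All graphs are finite and simple. For a graph $G$, let $\Delta(G)$ be its maximum degree and let $\mathrm{mad}(G)$ be the maximum of $2|E(H)|/|V(H)|$ over all (non-empty) subgraphs $H$ of $G$. A (not necessarily proper) vertex coloring of $G$ is injective if no vertex has two neighbors with the same color. Let $\chi^i_\ell(G)$ be the least integer $k$ such that, for every assignment of a set $L(v)$ of $k$ colors to each vertex $v$ of $G$, there is an injective coloring $c$ of $G$ with $c(v)\in L(v)$ for every vertex $v$. There is a function $f$ such that for every $\varepsilon>0$, every graph $G$ with $\mathrm{mad}(G)<3-\varepsilon$ and $\Delta(G)\ge f(\varepsilon)$ satisfies $\chi^i_\ell(G)=\Delta(G)$. The bound $3$ is sharp: for every $n$ there is a graph $G$ with $\mathrm{mad}(G)<3$ and $\Delta(G)\ge n$ that has no injective coloring with $\Delta(G)$ colors; in particular $\chi^i_\ell(G)>\Delta(G)$. -/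

import Mathlib

namespace SimpleGraph

/-- The average degree `2|E(H)| / |V(H)|` of a subgraph `H` (with value `0` if `H` has no
vertices). -/
noncomputable def Subgraph.averageDegree {V : Type*} {G : SimpleGraph V} (H : G.Subgraph) : ℝ :=
  2 * (H.edgeSet.ncard : ℝ) / (H.verts.ncard : ℝ)

/-- The maximum average degree `mad(G)` of a finite graph: the maximum of the average degrees of
its subgraphs. There are finitely many of them, so the supremum is attained; the subgraph without
vertices contributes `0`, which is at most every other term. -/
noncomputable def maxAverageDegree {V : Type*} (G : SimpleGraph V) : ℝ :=
  ⨆ H : G.Subgraph, H.averageDegree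

/-- A (not necessarily proper) vertex coloring is injective if no vertex has two neighbors with
the same color. -/
def IsInjectiveColoring {V α : Type*} (G : SimpleGraph V) (c : V → α) : Prop :=
  ∀ v : V, Set.InjOn c (G.neighborSet v)

/-- `G` has an injective coloring with `k` colors. -/
def InjectivelyColorable {V : Type*} (G : SimpleGraph V) (k : ℕ) : Prop :=
  ∃ c : V → Fin k, G.IsInjectiveColoring c

/-- `G` is list injectively `k`-colorable: whatever set of `k` colors is assigned to each vertex,
there is an injective coloring in which every vertex receives a color from its own set. -/
def ListInjectivelyColorable {V : Type*} (G : SimpleGraph V) (k : ℕ) : Prop :=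
  ∀ (α : Type) (L : V → Finset α), (∀ v, (L v).card = k) →
    ∃ c : V → α, (∀ v, c v ∈ L v) ∧ G.IsInjectiveColoring c

/-- The list injective chromatic number: the least `k` such that `G` is list injectively
`k`-colorable (`⊤` if there is no such `k`, which cannot happen for a finite graph). -/
noncomputable def listInjectiveChromaticNumber {V : Type*} (G : SimpleGraph V) : ℕ∞ :=
  ⨅ k ∈ {k : ℕ | G.ListInjectivelyColorable k}, (k : ℕ∞)

end SimpleGraph

open Finset

/-! The neighbors of a vertex of maximum degree need distinct colors, so only the upper bound takes
work. Fix `k` above all degrees and lists of size at least `k`, and suppose that `G` is not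
colorable although every graph obtained from it by deleting vertices is. Discharging shows that its
average degree is at least `3 - ε`.

Put `D ≈ 2/ε`, `M ≈ 2(D+3)/ε`, `k > M²`, and call a vertex big if its degree is at least `M`. A
small vertex without big neighbors has fewer than `k` conflicts and can be colored last. Hence all
degrees are at least 2, and a vertex of degree 2 without big neighbors has only neighbors that see a
big vertex. Start with charge `deg - 3 + ε`; each big vertex gives `1 - ε/2` to every neighbor and
still keeps `D`. What remains critical are the components of `linkGraph`: vertices with exactly one
big neighbor, joined through vertices of degree 2. Such a component lacks charge, by at most one
unit, only if it is tight: a tree on at most `D` vertices without further edges.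

If there were more than `D` tight components per big vertex, Hall's theorem
(`exists_subfamily_with_private_members`) would give a subfamily in which every attached big vertex
has `D` private components. Delete its linking vertices, color the rest, and recolor its components:
the conflicts form disjoint cliques (one per big vertex) plus a bipartite graph of maximum degree at
most `D`, which the kernel method (`exists_list_coloring_of_cliques`) colors. This contradiction is
`card_tightComponents_le`, and the `D` units kept by each big vertex pay for the tight components.

Sharpness is witnessed by `hubGraph`, where counting colors at the hubs forces both hubs to share
the color of the apex. -/

namespace SimpleGraph

/-! ### Average degrees and the lower bound by the maximum degree -/

open scoped Classical in
/-- The handshake identity for a subgraph. -/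
theorem Subgraph.two_mul_ncard_edgeSet {V : Type*} [Fintype V] {G : SimpleGraph V}
    (H : G.Subgraph) : 2 * H.edgeSet.ncard = ∑ v, #{w | H.Adj v w} := by
  have h := H.spanningCoe.sum_degrees_eq_twice_card_edges
  rw [← Subgraph.edgeSet_spanningCoe, ← coe_edgeFinset, Set.ncard_coe_finset, ← h]
  refine Finset.sum_congr rfl fun v _ => ?_
  rw [← card_neighborFinset_eq_degree]
  congr 1
  ext w
  simp

theorem averageDegree_le_maxAverageDegree {V : Type*} [Finite V] {G : SimpleGraph V}
    (H : G.Subgraph) : H.averageDegree ≤ G.maxAverageDegree :=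
  le_ciSup (Set.finite_range _).bddAbove H

open scoped Classical in
/-- Every induced subgraph obeys the bound that the maximum average degree gives. -/
theorem sum_card_adj_lt_of_maxAverageDegree_lt {V : Type*} [Fintype V] {G : SimpleGraph V} {a : ℝ}
    (h : G.maxAverageDegree < a) {S : Finset V} (hS : S.Nonempty) :
    ((∑ v ∈ S, #{w ∈ S | G.Adj v w} : ℕ) : ℝ) < a * #S := by
  let H := (⊤ : G.Subgraph).induce (S : Set V)
  have h1 : H.averageDegree < a := (averageDegree_le_maxAverageDegree H).trans_lt h
  have h2 := H.two_mul_ncard_edgeSet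
  have h3 : ∑ v, #{w | H.Adj v w} = ∑ v ∈ S, #{w ∈ S | G.Adj v w} := by
    rw [← Finset.sum_subset (Finset.subset_univ S)]
    · refine Finset.sum_congr rfl fun v hv => ?_
      congr 1
      ext w
      simp [H, hv]
    · intro v _ hv
      simp [H, hv]
  have hv : H.verts.ncard = #S := by simp [H]
  have hpos : (0 : ℝ) < #S := by exact_mod_cast hS.card_pos
  rw [Subgraph.averageDegree, hv, div_lt_iff₀ hpos] at h1
  have h4 : 2 * H.edgeSet.ncard = ∑ v ∈ S, #{w ∈ S | G.Adj v w} := by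
    rw [← h3]
    convert h2
  rw [← h4]
  push_cast
  exact h1

theorem maxDegree_le_of_listInjectivelyColorable {V : Type*} [Fintype V] {G : SimpleGraph V}
    [DecidableRel G.Adj] {k : ℕ} (h : G.ListInjectivelyColorable k) : G.maxDegree ≤ k := by
  obtain ⟨c, -, hc⟩ := h (Fin k) (fun _ => Finset.univ) (by simp)
  refine maxDegree_le_of_forall_degree_le _ _ fun v => ?_
  rw [← card_neighborFinset_eq_degree]
  have := Finset.card_le_card_of_injOn (s := G.neighborFinset v) (t := Finset.univ) c
    (by simp) (by simpa using hc v)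
  simpa using this

/-! ### Sharpness of the bound 3 -/

/-- Two hubs with a common neighbor, the apex, and `m` further paths of length three between
them. -/
def hubGraph (m : ℕ) : SimpleGraph (Unit ⊕ Bool ⊕ Fin m × Bool) :=
  SimpleGraph.fromRel fun u v => match u, v with
    | .inl _, .inr (.inl _) => True
    | .inr (.inl s), .inr (.inr p) => p.2 = s
    -- The case `p = p'` is harmless, since `fromRel` discards loops.
    | .inr (.inr p), .inr (.inr p') => p.1 = p'.1
    | _, _ => False

section hubGraph

variable {m : ℕ}

@[simp] theorem hubGraph_apex_apex (a b : Unit) : ¬ (hubGraph m).Adj (.inl a) (.inl b) := by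
  simp [hubGraph]

@[simp] theorem hubGraph_apex_hub (a : Unit) (s : Bool) :
    (hubGraph m).Adj (.inl a) (.inr (.inl s)) := by
  simp [hubGraph]

@[simp] theorem hubGraph_apex_path (a : Unit) (p : Fin m × Bool) :
    ¬ (hubGraph m).Adj (.inl a) (.inr (.inr p)) := by
  simp [hubGraph]

@[simp] theorem hubGraph_hub_hub (s s' : Bool) :
    ¬ (hubGraph m).Adj (.inr (.inl s)) (.inr (.inl s')) := by
  simp [hubGraph]

@[simp] theorem hubGraph_hub_path (s : Bool) (p : Fin m × Bool) :
    (hubGraph m).Adj (.inr (.inl s)) (.inr (.inr p)) ↔ p.2 = s := by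
  simp [hubGraph]

@[simp] theorem hubGraph_path_path (p p' : Fin m × Bool) :
    (hubGraph m).Adj (.inr (.inr p)) (.inr (.inr p')) ↔ p' = (p.1, !p.2) := by
  obtain ⟨i, s⟩ := p
  obtain ⟨j, t⟩ := p'
  simp only [hubGraph, fromRel_adj, ne_eq, Sum.inr.injEq, Prod.mk.injEq]
  cases s <;> cases t <;> simp [eq_comm]

-- Each path has at most three edges to charge to its two inner vertices, and `2e ≤ 3n` survives
-- path by path when parts are missing. Strictness comes from the apex and the hubs, which carry
-- only two edges on three vertices; if all three are absent, it comes from any path that is met.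
open scoped Classical in
theorem hubGraph_two_mul_card_lt (H : (hubGraph m).Subgraph) (hH : H.verts.Nonempty) :
    2 * H.edgeSet.ncard < 3 * H.verts.ncard := by
  have hv : H.verts.ncard = ∑ v, if v ∈ H.verts then 1 else 0 := by
    rw [Set.ncard_eq_toFinset_card', ← Finset.card_filter]
    congr 1
    ext v
    simp
  -- Indicators: `q` for middle edges of paths, `r` for edges from hubs to paths, `t` for edges at
  -- the apex, `n` for vertices.
  obtain ⟨q, hq⟩ : ∃ q : Fin m → ℕ, ∀ i, q i =
    if H.Adj (.inr (.inr (i, false))) (.inr (.inr (i, true))) then 1 else 0 := ⟨_, fun _ => rfl⟩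
  obtain ⟨r, hr⟩ : ∃ r : Fin m → Bool → ℕ, ∀ i s, r i s =
    if H.Adj (.inr (.inl s)) (.inr (.inr (i, s))) then 1 else 0 := ⟨_, fun _ _ => rfl⟩
  obtain ⟨t, ht⟩ : ∃ t : Bool → ℕ, ∀ s, t s =
    if H.Adj (.inl ()) (.inr (.inl s)) then 1 else 0 := ⟨_, fun _ => rfl⟩
  obtain ⟨n, hn⟩ : ∃ n : Unit ⊕ Bool ⊕ Fin m × Bool → ℕ, ∀ v, n v =
    if v ∈ H.verts then 1 else 0 := ⟨_, fun _ => rfl⟩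
  have hpp : ∀ p p', (if H.Adj (.inr (.inr p)) (.inr (.inr p')) then 1 else 0) =
      if p' = (p.1, !p.2) then q p.1 else 0 := by
    rintro ⟨i, s⟩ p'
    by_cases h : p' = (i, !s)
    · subst h
      rw [if_pos rfl, hq]
      cases s
      · rfl
      · simp [H.adj_comm (.inr (.inr (i, true)))]
    · rw [if_neg h, if_neg fun h' => h ((hubGraph_path_path _ _).1 h'.adj_sub)]
  have hhp : ∀ s i s', (if H.Adj (.inr (.inl s)) (.inr (.inr (i, s'))) then 1 else 0) =
      if s' = s then r i s else 0 := by
    intro s i s'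
    by_cases h : s' = s
    · subst h
      rw [if_pos rfl, hr]
    · rw [if_neg h, if_neg fun h' => h ((hubGraph_hub_path _ _).1 h'.adj_sub)]
  have hph : ∀ s i s', (if H.Adj (.inr (.inr (i, s'))) (.inr (.inl s)) then 1 else 0) =
      if s' = s then r i s else 0 := by
    intro s i s'
    rw [← hhp]
    simp only [H.adj_comm]
  have hha : ∀ s, (if H.Adj (.inr (.inl s)) (.inl ()) then 1 else 0) = t s := by
    intro s
    rw [ht]
    simp only [H.adj_comm]
  have haa : ∀ a b, ¬ H.Adj (.inl a) (.inl b) := fun a b h => hubGraph_apex_apex _ _ h.adj_sub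
  have hap : ∀ a p, ¬ H.Adj (.inl a) (.inr (.inr p)) :=
    fun a b h => hubGraph_apex_path _ _ h.adj_sub
  have hpa : ∀ a p, ¬ H.Adj (.inr (.inr p)) (.inl a) :=
    fun a b h => hubGraph_apex_path _ _ h.adj_sub.symm
  have hhh : ∀ s t, ¬ H.Adj (.inr (.inl s)) (.inr (.inl t)) :=
    fun a b h => hubGraph_hub_hub _ _ h.adj_sub
  have hE : 2 * H.edgeSet.ncard = 2 * (t true + t false) +
      ∑ i, 2 * (q i + r i true + r i false) := by
    rw [H.two_mul_ncard_edgeSet]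
    simp only [Finset.card_filter, Fintype.sum_sum_type, Finset.univ_unique, PUnit.default_eq_unit,
      Finset.sum_singleton, hpp, haa, hap, hpa, hhh, if_false, hha, ← ht, Finset.sum_ite_eq',
      Finset.mem_univ, if_true, Finset.sum_const_zero]
    simp only [Fintype.sum_prod_type, Fintype.sum_bool, hhp, hph]
    simp only [if_true, Bool.true_eq_false, Bool.false_eq_true, if_false, Finset.sum_add_distrib,
      Finset.sum_const_zero, ← Finset.mul_sum]
    ring
  have hV : H.verts.ncard = n (.inl ()) + n (.inr (.inl true)) + n (.inr (.inl false)) +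
      ∑ i, (n (.inr (.inr (i, true))) + n (.inr (.inr (i, false)))) := by
    rw [hv]
    simp only [← hn, Fintype.sum_sum_type, Fintype.sum_prod_type, Fintype.sum_bool,
      Finset.univ_unique, PUnit.default_eq_unit, Finset.sum_singleton]
    ring
  have hn1 : ∀ v, n v ≤ 1 := fun v => by rw [hn]; split_ifs <;> simp
  have hadj : ∀ u v, (if H.Adj u v then 1 else 0) ≤ n u ∧ (if H.Adj u v then 1 else 0) ≤ n v := by
    intro u v
    by_cases h : H.Adj u v
    · simp [hn, h, h.fst_mem, h.snd_mem]
    · simp [h]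
  have hqn : ∀ i, q i ≤ n (.inr (.inr (i, false))) ∧ q i ≤ n (.inr (.inr (i, true))) :=
    fun i => by rw [hq]; exact hadj _ _
  have hrn : ∀ i s, r i s ≤ n (.inr (.inl s)) ∧ r i s ≤ n (.inr (.inr (i, s))) :=
    fun i s => by rw [hr]; exact hadj _ _
  have htn : ∀ s, t s ≤ n (.inl ()) ∧ t s ≤ n (.inr (.inl s)) :=
    fun s => by rw [ht]; exact hadj _ _
  have hle : ∀ i, 2 * (q i + r i true + r i false) ≤
      3 * (n (.inr (.inr (i, true))) + n (.inr (.inr (i, false)))) := by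
    intro i
    have := hqn i
    have := hrn i true
    have := hrn i false
    have := hn1 (.inr (.inr (i, true)))
    have := hn1 (.inr (.inr (i, false)))
    omega
  have hsum := Finset.sum_le_sum fun i (_ : i ∈ Finset.univ) => hle i
  have := htn true
  have := htn false
  have := hn1 (.inl ())
  have := hn1 (.inr (.inl true))
  have := hn1 (.inr (.inl false))
  simp only [← Finset.mul_sum] at hsum
  simp only [← Finset.mul_sum] at hE
  rw [hE, hV]
  by_cases h0 : n (.inl ()) = 0 ∧ n (.inr (.inl true)) = 0 ∧ n (.inr (.inl false)) = 0
  · obtain ⟨v, hvH⟩ := hH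
    obtain ⟨ha0, ht0, hf0⟩ := h0
    have hnv : n v = 1 := by rw [hn, if_pos hvH]
    have hstrict : ∑ i, 2 * (q i + r i true + r i false) <
        ∑ i, 3 * (n (.inr (.inr (i, true))) + n (.inr (.inr (i, false)))) := by
      refine Finset.sum_lt_sum (fun i _ => hle i) ?_
      rcases v with v | v | ⟨i, s⟩
      · exact absurd (hnv.symm.trans ha0) one_ne_zero
      · cases v <;> omega
      · refine ⟨i, Finset.mem_univ _, ?_⟩
        have := hqn i
        have := hrn i true
        have := hrn i false
        cases s <;> omega
    simp only [← Finset.mul_sum] at hstrict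
    omega
  · omega

theorem hubGraph_maxAverageDegree_lt : (hubGraph m).maxAverageDegree < 3 := by
  obtain ⟨H, hH⟩ := exists_eq_ciSup_of_finite
    (f := fun H : (hubGraph m).Subgraph => H.averageDegree)
  rw [maxAverageDegree, ← hH, Subgraph.averageDegree]
  rcases H.verts.eq_empty_or_nonempty with h0 | h0
  · simp [h0]
  · have hpos : (0 : ℝ) < H.verts.ncard := by
      exact_mod_cast (Set.ncard_pos (Set.toFinite _)).2 h0
    rw [div_lt_iff₀ hpos]
    exact_mod_cast hubGraph_two_mul_card_lt H h0

open scoped Classical in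
theorem hubGraph_neighborFinset_hub [DecidableRel (hubGraph m).Adj] (s : Bool) :
    (hubGraph m).neighborFinset (.inr (.inl s)) =
      insert (.inl ()) (Finset.univ.image fun i : Fin m => .inr (.inr (i, s))) := by
  ext v
  rcases v with v | v | ⟨i, s'⟩
  · simp [adj_comm _ _ (Sum.inl v)]
  · simp
  · simp [eq_comm]

theorem hubGraph_degree_hub [DecidableRel (hubGraph m).Adj] (s : Bool) :
    (hubGraph m).degree (.inr (.inl s)) = m + 1 := by
  rw [← card_neighborFinset_eq_degree, hubGraph_neighborFinset_hub, Finset.card_insert_of_notMem]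
  · rw [Finset.card_image_of_injective _ fun i j h => by simpa using h]
    simp
  · simp

theorem hubGraph_maxDegree [DecidableRel (hubGraph m).Adj] (hm : 1 ≤ m) :
    (hubGraph m).maxDegree = m + 1 := by
  refine le_antisymm (maxDegree_le_of_forall_degree_le _ _ ?_)
    ((hubGraph_degree_hub true).symm.le.trans (degree_le_maxDegree _ _))
  rintro (a | s | ⟨i, s⟩)
  · rw [← card_neighborFinset_eq_degree]
    refine (Finset.card_le_card (t := {.inr (.inl true), .inr (.inl false)}) ?_).trans
      (Finset.card_le_two.trans (by omega))
    rintro (b | t | p) <;> simp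
  · exact (hubGraph_degree_hub s).le
  · rw [← card_neighborFinset_eq_degree]
    refine (Finset.card_le_card (t := {.inr (.inl s), .inr (.inr (i, !s))}) ?_).trans
      (Finset.card_le_two.trans (by omega))
    rintro (b | t | p)
    · simp [adj_comm _ _ (Sum.inl b)]
    · simp [adj_comm _ _ (Sum.inr (Sum.inl t)), eq_comm]
    · simp

/-- Each hub has `m + 1` neighbors and so sees every color, in particular that of the other hub. No
path vertex next to it can carry this color, because its partner on the path is adjacent to it and
to the other hub. So the apex carries it; by symmetry both hubs have the color of the apex, their
common neighbor. -/
theorem hubGraph_not_injectivelyColorable : ¬ (hubGraph m).InjectivelyColorable (m + 1) := by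
  classical
  rintro ⟨c, hc⟩
  have key : ∀ s, c (.inr (.inl !s)) = c (.inl ()) := by
    intro s
    have hinj := hc (.inr (.inl s))
    have himg : ((hubGraph m).neighborFinset (.inr (.inl s))).image c = Finset.univ := by
      rw [← Finset.card_eq_iff_eq_univ, Finset.card_image_of_injOn (by simpa using hinj),
        card_neighborFinset_eq_degree, hubGraph_degree_hub, Fintype.card_fin]
    have hmem := Finset.mem_univ (c (.inr (.inl !s)))
    rw [← himg, hubGraph_neighborFinset_hub] at hmem
    simp only [Finset.mem_image, Finset.mem_insert, Finset.mem_univ, true_and] at hmem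
    obtain ⟨v, rfl | ⟨i, rfl⟩, hv⟩ := hmem
    · exact hv.symm
    · have := hc (.inr (.inr (i, !s))) (x₁ := .inr (.inr (i, s))) (x₂ := .inr (.inl !s))
        (by simp) (by simp [adj_comm _ _ (Sum.inr (Sum.inl !s))]) hv
      simp at this
  have h := hc (.inl ()) (x₁ := .inr (.inl true)) (x₂ := .inr (.inl false)) (by simp) (by simp)
    ((key false).trans (key true).symm)
  simp at h

end hubGraph

/-! ### List coloring by kernels -/

/-- If every induced subdigraph of a digraph on `P` has a kernel, then lists that are longer than
the outdegrees admit a proper coloring. -/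
theorem exists_list_coloring_of_kernels {V α : Type*} [DecidableEq V] [DecidableEq α]
    [Nonempty α]     (O : V → V → Prop) [DecidableRel O] (P : Finset V)
    (hker : ∀ S ⊆ P, ∃ K ⊆ S, (∀ u ∈ K, ∀ w ∈ K, ¬ O u w) ∧ ∀ u ∈ S, u ∉ K → ∃ w ∈ K, O u w)
    (L : V → Finset α) (hL : ∀ u ∈ P, #{w ∈ P | O u w} < #(L u)) :
    ∃ c : V → α, (∀ u ∈ P, c u ∈ L u) ∧ ∀ u ∈ P, ∀ w ∈ P, O u w → c u ≠ c w := by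
  induction hn : #P using Nat.strong_induction_on generalizing P L with
  | _ n ih =>
  subst hn
  rcases P.eq_empty_or_nonempty with rfl | ⟨u₀, hu₀⟩
  · exact ⟨fun _ => Classical.arbitrary α, by simp⟩
  · obtain ⟨a, ha⟩ : (L u₀).Nonempty := Finset.card_pos.1 ((Nat.zero_le _).trans_lt (hL u₀ hu₀))
    -- The kernel `K` of the vertices that allow `a` receives `a`. Every other vertex that loses `a`
    -- from its list also loses an out-neighbor in `K`.
    obtain ⟨K, hKS, hind, habs⟩ := hker {u ∈ P | a ∈ L u} (Finset.filter_subset _ _)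
    have hKP : K ⊆ P := hKS.trans (Finset.filter_subset _ _)
    have hKne : K.Nonempty := by
      by_contra h
      rw [Finset.not_nonempty_iff_eq_empty] at h
      subst h
      obtain ⟨w, hw, -⟩ := habs u₀ (by simp [hu₀, ha]) (by simp)
      simp at hw
    have hlt : #(P \ K) < #P :=
      Finset.card_lt_card (Finset.sdiff_ssubset hKP hKne)
    obtain ⟨c, hc, hc'⟩ := ih _ hlt (P \ K) (fun S hS => hker S (hS.trans Finset.sdiff_subset))
      (fun u => (L u).erase a) (by
        intro u hu
        rw [Finset.mem_sdiff] at hu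
        by_cases hau : a ∈ L u
        · obtain ⟨w, hw, huw⟩ := habs u (by simp [hu.1, hau]) hu.2
          have h1 : #{w ∈ P \ K | O u w} < #{w ∈ P | O u w} := by
            refine Finset.card_lt_card ⟨Finset.filter_subset_filter _ Finset.sdiff_subset,
              fun h => ?_⟩
            have := h (Finset.mem_filter.2 ⟨hKP hw, huw⟩)
            simp [hw] at this
          have := hL u hu.1
          rw [Finset.card_erase_of_mem hau]
          omega
        · rw [Finset.erase_eq_of_notMem hau]
          exact (Finset.card_le_card (Finset.filter_subset_filter _ Finset.sdiff_subset)).trans_lt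
            (hL u hu.1)) rfl
    refine ⟨fun u => if u ∈ K then a else c u, fun u hu => ?_, fun u hu w hw huw => ?_⟩
    · by_cases huK : u ∈ K
      · simpa [huK] using (Finset.mem_filter.1 (hKS huK)).2
      · simpa [huK] using Finset.mem_of_mem_erase (hc u (by simp [hu, huK]))
    · by_cases huK : u ∈ K <;> by_cases hwK : w ∈ K
      · exact absurd huw (hind u huK w hwK)
      · simpa [huK, hwK] using (Finset.ne_of_mem_erase (hc w (by simp [hw, hwK]))).symm
      · simpa [huK, hwK] using Finset.ne_of_mem_erase (hc u (by simp [hu, huK]))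
      · simpa [huK, hwK] using hc' u (by simp [hu, huK]) w (by simp [hw, hwK]) huw

/-- Disjoint cliques, each ordered by `r`, together with arcs from non-sinks `u` to sinks `w`, have
a kernel. -/
theorem exists_kernel_of_cliques {V X : Type*} [DecidableEq V] (q : V → X) (r : V → ℕ)
    (hr : Function.Injective r) (A : V → V → Prop) (b : V → Prop)
    (hA : ∀ u w, A u w → ¬ b u ∧ b w) (S : Finset V) :
    ∃ K ⊆ S, (∀ u ∈ K, ∀ w ∈ K, ¬ (q u = q w ∧ r w < r u ∨ A u w)) ∧
      ∀ u ∈ S, u ∉ K → ∃ w ∈ K, q u = q w ∧ r w < r u ∨ A u w := by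
  classical
  induction hn : #S using Nat.strong_induction_on generalizing S with
  | _ n ih =>
  subst hn
  -- The minima of the cliques absorb everything and form a kernel unless some arc of `A` enters one
  -- of them. In that case the tail of the arc can be removed: the minimum `w` has no arcs out, so
  -- it lies in any kernel of the rest and absorbs the tail.
  by_cases h : ∃ u ∈ S, ∃ w ∈ S, A u w ∧ ∀ z ∈ S, q w = q z → r w ≤ r z
  · obtain ⟨u, hu, w, hw, huw, hmin⟩ := h
    have hne : w ≠ u := by
      rintro rfl
      exact (hA _ _ huw).1 (hA _ _ huw).2
    obtain ⟨K, hKS, hind, habs⟩ := ih _ (Finset.card_erase_lt_of_mem hu) (S.erase u) rfl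
    refine ⟨K, hKS.trans (Finset.erase_subset _ _), hind, fun z hz hzK => ?_⟩
    by_cases hzu : z = u
    · subst hzu
      refine ⟨w, ?_, .inr huw⟩
      by_contra hwK
      obtain ⟨z', hz', h' | h'⟩ := habs w (Finset.mem_erase.2 ⟨hne, hw⟩) hwK
      · exact absurd (hmin z' (Finset.mem_of_mem_erase (hKS hz')) h'.1) (by omega)
      · exact (hA _ _ h').1 (hA _ _ huw).2
    · exact habs z (Finset.mem_erase.2 ⟨hzu, hz⟩) hzK
  · push Not at h
    refine ⟨{w ∈ S | ∀ z ∈ S, q w = q z → r w ≤ r z}, Finset.filter_subset _ _, ?_, ?_⟩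
    · intro u hu w hw
      rw [Finset.mem_filter] at hu hw
      rintro (h' | h')
      · exact absurd (hu.2 w hw.1 h'.1) (by omega)
      · obtain ⟨z, hz, hz', hz''⟩ := h u hu.1 w hw.1 h'
        exact absurd (hw.2 z hz hz') (by omega)
    · intro u hu hu'
      obtain ⟨w, hw, hmin⟩ := Finset.exists_min_image {w ∈ S | q u = q w} r ⟨u, by simp [hu]⟩
      rw [Finset.mem_filter] at hw
      have hw' : ∀ z ∈ S, q w = q z → r w ≤ r z := fun z hz hqz =>
        hmin z (Finset.mem_filter.2 ⟨hz, hw.2.trans hqz⟩)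
      refine ⟨w, Finset.mem_filter.2 ⟨hw.1, hw'⟩, .inl ⟨hw.2, ?_⟩⟩
      refine lt_of_le_of_ne (hmin u (by simp [hu])) fun h' => ?_
      rw [hr h'] at hw'
      exact hu' (Finset.mem_filter.2 ⟨hu, hw'⟩)

/-- A union of disjoint cliques and a bipartite graph of maximum degree at most `D` can be colored
from lists as long as the cliques, provided that every clique has at least `D` vertices on the
side `b`. -/
theorem exists_list_coloring_of_cliques {V X α : Type*} [Finite V] [DecidableEq V] [DecidableEq X]
    [DecidableEq α] [Nonempty α]
    (P : Finset V) (q : V → X) (A : V → V → Prop) [DecidableRel A] (b : V → Prop) [DecidablePred b]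
    (hA : ∀ u ∈ P, ∀ w ∈ P, A u w → (b u ↔ ¬ b w)) (hAs : ∀ u w, A u w → A w u) (D : ℕ)
    (hD : ∀ u ∈ P, #{w ∈ P | A u w} ≤ D) (hb : ∀ u ∈ P, D ≤ #{w ∈ P | q u = q w ∧ b w})
    (L : V → Finset α) (hL : ∀ u ∈ P, #{w ∈ P | q u = q w} ≤ #(L u)) :
    ∃ c : V → α, (∀ u ∈ P, c u ∈ L u) ∧
      ∀ u ∈ P, ∀ w ∈ P, u ≠ w → q u = q w ∨ A u w → c u ≠ c w := by
  obtain ⟨n, ⟨e⟩⟩ := Finite.exists_equiv_fin V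
  -- The shift by `n` places the side `b` above the other side; clique arcs point downwards.
  let r : V → ℕ := fun v => (e v : ℕ) + if b v then n else 0
  have hrb : ∀ u w, ¬ b u → b w → r u < r w := by
    intro u w hu hw
    have := (e u).isLt
    simp only [r, hu, hw, if_true, if_false]
    omega
  have hr : Function.Injective r := by
    intro u w huw
    by_cases hu : b u <;> by_cases hw : b w
    · exact e.injective (Fin.ext (by simpa [r, hu, hw] using huw))
    · exact absurd (hrb w u hw hu) (by omega)
    · exact absurd (hrb u w hu hw) (by omega)
    · exact e.injective (Fin.ext (by simpa [r, hu, hw] using huw))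
  let B : V → V → Prop := fun u w => (u ∈ P ∧ w ∈ P ∧ A u w) ∧ ¬ b u ∧ b w
  obtain ⟨c, hc, hc'⟩ := exists_list_coloring_of_kernels
    (fun u w => q u = q w ∧ r w < r u ∨ B u w) P
    (fun S _ => exists_kernel_of_cliques q r hr B b (fun u w h => h.2) S) L (by
      intro u hu
      refine lt_of_lt_of_le ?_ (hL u hu)
      -- A vertex of side `b` has only clique arcs. Any other vertex has at most `D` arcs across,
      -- made up for by at least `D` members of `b` in its clique, all of them above it.
      by_cases hbu : b u
      · refine Finset.card_lt_card ⟨fun w hw => ?_, fun h => ?_⟩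
        · rw [Finset.mem_filter] at hw ⊢
          rcases hw.2 with h | h
          · exact ⟨hw.1, h.1⟩
          · exact absurd hbu h.2.1
        · have := h (Finset.mem_filter.2 ⟨hu, rfl⟩)
          simp [B] at this
      · have h1 : #{w ∈ P | q u = q w ∧ r w < r u ∨ B u w} ≤
            #{w ∈ P | q u = q w ∧ r w < r u} + #{w ∈ P | A u w} := by
          rw [Finset.filter_or]
          refine (Finset.card_union_le _ _).trans (Nat.add_le_add_left
            (Finset.card_le_card fun w hw => ?_) _)
          rw [Finset.mem_filter] at hw ⊢
          exact ⟨hw.1, hw.2.1.2.2⟩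
        have h2 : #{w ∈ P | q u = q w ∧ r w < r u} + #{w ∈ P | q u = q w ∧ b w} <
            #{w ∈ P | q u = q w} := by
          rw [← Finset.card_union_of_disjoint]
          · refine Finset.card_lt_card ⟨fun w hw => ?_, fun h => ?_⟩
            · simp only [Finset.mem_union, Finset.mem_filter] at hw ⊢
              rcases hw with h | h
              · exact ⟨h.1, h.2.1⟩
              · exact ⟨h.1, h.2.1⟩
            · have := h (Finset.mem_filter.2 ⟨hu, rfl⟩)
              simp [hbu] at this
          · rw [Finset.disjoint_filter]
            rintro w - ⟨-, hw⟩ ⟨-, hw'⟩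
            exact absurd (hrb u w hbu hw') (by omega)
        have := hD u hu
        have := hb u hu
        omega)
  refine ⟨c, hc, fun u hu w hw hne h => ?_⟩
  rcases h with h | h
  · rcases lt_or_gt_of_ne (hr.ne hne) with h' | h'
    · exact (hc' w hw u hu (.inl ⟨h.symm, h'⟩)).symm
    · exact hc' u hu w hw (.inl ⟨h, h'⟩)
  · by_cases hbu : b u
    · exact (hc' w hw u hu (.inr ⟨⟨hw, hu, hAs _ _ h⟩, (hA u hu w hw h).1 hbu, hbu⟩)).symm
    · refine hc' u hu w hw (.inr ⟨⟨hu, hw, h⟩, hbu, ?_⟩)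
      by_contra hbw
      exact hbu ((hA u hu w hw h).2 hbw)

/-! ### Conflicts and greedy extension -/

/-- Two vertices conflict if they have a common neighbor. -/
def conflictGraph {V : Type*} (G : SimpleGraph V) : SimpleGraph V where
  Adj u w := u ≠ w ∧ ∃ z, G.Adj z u ∧ G.Adj z w
  symm := ⟨fun _ _ h => ⟨h.1.symm, h.2.imp fun _ h' => h'.symm⟩⟩
  loopless := ⟨fun _ h => h.1 rfl⟩

theorem isInjectiveColoring_iff {V α : Type*} {G : SimpleGraph V} {c : V → α} :
    G.IsInjectiveColoring c ↔ ∀ u w, G.conflictGraph.Adj u w → c u ≠ c w := by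
  constructor
  · rintro h u w ⟨hne, z, hu, hw⟩ hc
    exact hne (h z hu hw hc)
  · intro h z u hu w hw hc
    by_contra hne
    exact h u w ⟨hne, z, hu, hw⟩ hc

open scoped Classical in
/-- A proper coloring of `S` from lists extends if all other vertices have degree less than the
size of their list. -/
theorem exists_extend_list_coloring {V α : Type*} [Fintype V] (Q : SimpleGraph V)
    (L : V → Finset α) (S : Finset V) (c : V → α) (hc : ∀ u ∈ S, c u ∈ L u)
    (hQ : ∀ u ∈ S, ∀ w ∈ S, Q.Adj u w → c u ≠ c w)
    (hdeg : ∀ v ∉ S, Q.degree v < #(L v)) :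
    ∃ c : V → α, (∀ u, c u ∈ L u) ∧ ∀ u w, Q.Adj u w → c u ≠ c w := by
  induction hn : #Sᶜ using Nat.strong_induction_on generalizing S c with
  | _ n ih =>
  subst hn
  by_cases hS : ∃ v, v ∉ S
  · obtain ⟨v, hv⟩ := hS
    obtain ⟨a, haL, ha⟩ : ∃ a ∈ L v, a ∉ (Q.neighborFinset v).image c :=
      Finset.exists_mem_notMem_of_card_lt_card (Finset.card_image_le.trans_lt (hdeg v hv))
    have ha' : ∀ w, Q.Adj v w → a ≠ c w := fun w hw h =>
      ha (Finset.mem_image.2 ⟨w, by simpa using hw, h.symm⟩)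
    refine ih _ (Finset.card_lt_card ?_) (insert v S) (Function.update c v a) ?_ ?_
      (fun w hw => hdeg w fun h => hw (Finset.mem_insert_of_mem h)) rfl
    · rw [Finset.compl_ssubset_compl]
      exact Finset.ssubset_insert hv
    · intro u hu
      by_cases huv : u = v
      · subst huv
        simpa using haL
      · rw [Function.update_of_ne huv]
        exact hc u (Finset.mem_of_mem_insert_of_ne hu huv)
    · intro u hu w hw huw
      by_cases huv : u = v
      · subst huv
        rw [Function.update_self, Function.update_of_ne huw.ne']
        exact ha' w huw
      · by_cases hwv : w = v
        · subst hwv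
          rw [Function.update_self, Function.update_of_ne huv]
          exact (ha' u huw.symm).symm
        · rw [Function.update_of_ne huv, Function.update_of_ne hwv]
          exact hQ u (Finset.mem_of_mem_insert_of_ne hu huv) w
            (Finset.mem_of_mem_insert_of_ne hw hwv) huw
  · push Not at hS
    exact ⟨c, fun u => hc u (hS u), fun u w => hQ u (hS u) w (hS w)⟩

open scoped Classical in
theorem degree_conflictGraph_le {V : Type*} [Fintype V] (G : SimpleGraph V) (v : V) :
    G.conflictGraph.degree v ≤ ∑ z ∈ G.neighborFinset v, (G.degree z - 1) := by
  rw [← card_neighborFinset_eq_degree]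
  refine (Finset.card_le_card (t := (G.neighborFinset v).biUnion
    fun z => (G.neighborFinset z).erase v) ?_).trans (Finset.card_biUnion_le.trans ?_)
  · intro w hw
    rw [mem_neighborFinset] at hw
    obtain ⟨hne, z, hzv, hzw⟩ := hw
    simp only [Finset.mem_biUnion, mem_neighborFinset, Finset.mem_erase]
    exact ⟨z, hzv.symm, hne.symm, hzw⟩
  · refine Finset.sum_le_sum fun z hz => ?_
    rw [Finset.card_erase_of_mem (by simpa [adj_comm] using hz), card_neighborFinset_eq_degree]

/-! ### Deletions and reducible configurations -/

/-- The list assignment `L` admits an injective coloring of the graph that remains after the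
deletion of `R`. -/
def ListInjectivelyColorableOutside {V α : Type*} (G : SimpleGraph V) (L : V → Finset α)
    (R : Finset V) : Prop :=
  ∃ c : V → α, (∀ v ∉ R, c v ∈ L v) ∧ ∀ z ∉ R, ∀ u ∉ R, ∀ w ∉ R,
    G.Adj z u → G.Adj z w → u ≠ w → c u ≠ c w

theorem listInjectivelyColorableOutside_empty {V α : Type*} {G : SimpleGraph V}
    {L : V → Finset α} : G.ListInjectivelyColorableOutside L ∅ ↔
      ∃ c : V → α, (∀ v, c v ∈ L v) ∧ ∀ u w, G.conflictGraph.Adj u w → c u ≠ c w := by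
  constructor
  · rintro ⟨c, hc, hc'⟩
    refine ⟨c, fun v => hc v (by simp), fun u w ⟨hne, z, hzu, hzw⟩ => ?_⟩
    exact hc' z (by simp) u (by simp) w (by simp) hzu hzw hne
  · rintro ⟨c, hc, hc'⟩
    exact ⟨c, fun v _ => hc v, fun z _ u _ w _ hzu hzw hne => hc' u w ⟨hne, z, hzu, hzw⟩⟩

section Reducible

open scoped Classical

variable {V α : Type*} [Fintype V] {G : SimpleGraph V} {L : V → Finset α}

/-- If the deleted vertices `R` have at most one neighbor outside `X`, then a coloring of the rest
can be changed on `X` greedily. -/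
theorem ListInjectivelyColorableOutside.of_subset {R X : Finset V}
    (h : G.ListInjectivelyColorableOutside L R) (hRX : R ⊆ X)
    (hR : ∀ z ∈ R, ∀ u ∉ X, ∀ w ∉ X, G.Adj z u → G.Adj z w → u = w)
    (hX : ∀ v ∈ X, G.conflictGraph.degree v < #(L v)) :
    G.ListInjectivelyColorableOutside L ∅ := by
  obtain ⟨c, hc, hc'⟩ := h
  rw [listInjectivelyColorableOutside_empty]
  refine exists_extend_list_coloring G.conflictGraph L Xᶜ c
    (fun u hu => hc u fun h => Finset.mem_compl.1 hu (hRX h)) ?_ (by simpa using hX)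
  rintro u hu w hw ⟨hne, z, hzu, hzw⟩
  rw [Finset.mem_compl] at hu hw
  by_cases hz : z ∈ R
  · exact absurd (hR z hz u hu w hw hzu hzw) hne
  · exact hc' z hz u (fun h => hu (hRX h)) w (fun h => hw (hRX h)) hzu hzw hne

variable {k M : ℕ} (hdeg : ∀ v, G.degree v ≤ k) (hL : ∀ v, k ≤ #(L v))
  (hdel : ∀ R : Finset V, R.Nonempty → G.ListInjectivelyColorableOutside L R)
  (hnot : ¬ G.ListInjectivelyColorableOutside L ∅)

-- Deleting a vertex with at most one neighbor hides no conflict between other vertices, and the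
-- vertex itself has at most `k - 1` conflicts.
include hdeg hL hdel hnot in
theorem two_le_degree_of_not_colorable (hk : 1 ≤ k) (v : V) : 2 ≤ G.degree v := by
  by_contra! hv
  have hone : ∀ u w, G.Adj v u → G.Adj v w → u = w := by
    intro u w hu hw
    rw [← card_neighborFinset_eq_degree, Nat.lt_succ_iff, Finset.card_le_one] at hv
    exact hv u (by simpa using hu) w (by simpa using hw)
  refine hnot ((hdel {v} (by simp)).of_subset (Finset.Subset.refl _) ?_ ?_)
  · simp only [Finset.mem_singleton]
    rintro z rfl u - w -
    exact hone u w
  · simp only [Finset.mem_singleton]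
    rintro z rfl
    refine (degree_conflictGraph_le G z).trans_lt (lt_of_lt_of_le ?_ (hL z))
    have : ∑ u ∈ G.neighborFinset z, (G.degree u - 1) ≤ #(G.neighborFinset z) * (k - 1) :=
      Finset.sum_le_card_nsmul _ _ _ fun u _ => Nat.sub_le_sub_right (hdeg u) 1
    rw [card_neighborFinset_eq_degree] at this
    have h2 : G.degree z * (k - 1) ≤ 1 * (k - 1) := Nat.mul_le_mul_right _ (by omega)
    omega

theorem degree_conflictGraph_lt_of_small (hk : M * M + 1 ≤ k) {v : V} (hL : k ≤ #(L v))
    (hv : G.degree v ≤ M) (hN : ∀ u, G.Adj v u → G.degree u < M) :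
    G.conflictGraph.degree v < #(L v) := by
  refine (degree_conflictGraph_le G v).trans_lt (lt_of_lt_of_le ?_ hL)
  have : ∑ u ∈ G.neighborFinset v, (G.degree u - 1) ≤ #(G.neighborFinset v) * M :=
    Finset.sum_le_card_nsmul _ _ _ fun u hu => by
      have := hN u (by simpa using hu)
      omega
  rw [card_neighborFinset_eq_degree] at this
  have h2 : G.degree v * M ≤ M * M := Nat.mul_le_mul_right _ hv
  omega

-- Otherwise delete `v` and uncolor `u`. Only one other neighbor of `v` keeps its color, so no
-- conflict is hidden, and `u` and `v` both have so few conflicts that they can be colored last.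
include hL hdel hnot in
theorem exists_big_neighbor_of_not_colorable (hM : 2 ≤ M) (hk : M * M + 1 ≤ k) {u v : V}
    (hv : G.degree v = 2) (hvN : ∀ u, G.Adj v u → G.degree u < M) (huv : G.Adj v u) :
    ∃ x, G.Adj u x ∧ M ≤ G.degree x := by
  by_contra! hu
  refine hnot ((hdel {v} (by simp)).of_subset (X := {v, u}) (by simp) ?_ ?_)
  · simp only [Finset.mem_singleton, Finset.mem_insert, not_or]
    rintro z rfl w ⟨-, hw⟩ w' ⟨-, hw'⟩ hzw hzw'
    by_contra hne
    have : #{u, w, w'} ≤ #(G.neighborFinset z) := by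
      refine Finset.card_le_card ?_
      simp [Finset.insert_subset_iff, huv, hzw, hzw']
    rw [card_neighborFinset_eq_degree, hv, Finset.card_eq_three.2
      ⟨u, w, w', Ne.symm hw, Ne.symm hw', hne, rfl⟩] at this
    omega
  · simp only [Finset.mem_singleton, Finset.mem_insert]
    rintro z (rfl | rfl)
    · exact degree_conflictGraph_lt_of_small hk (hL _) (by omega) hvN
    · exact degree_conflictGraph_lt_of_small hk (hL _) (hvN _ huv).le hu

end Reducible

/-! ### Components of the link graph -/

/-- Two vertices of `U` are linked if they have a common neighbor in `T`. -/
def linkGraph {V : Type*} (G : SimpleGraph V) (U T : Finset V) : SimpleGraph V where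
  Adj u w := u ≠ w ∧ u ∈ U ∧ w ∈ U ∧ ∃ v ∈ T, G.Adj v u ∧ G.Adj v w
  symm := ⟨fun _ _ ⟨hne, hu, hw, v, hv, hvu, hvw⟩ => ⟨hne.symm, hw, hu, v, hv, hvw, hvu⟩⟩
  loopless := ⟨fun _ h => h.1 rfl⟩

section LinkGraph

open scoped Classical

variable {V : Type*} (G : SimpleGraph V) (U T : Finset V)

/-- The vertices of `U` in a component of the link graph. -/
noncomputable def linkVerts (C : (G.linkGraph U T).ConnectedComponent) : Finset V :=
  {u ∈ U | (G.linkGraph U T).connectedComponentMk u = C}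

/-- The vertices of `T` that link vertices of a component of the link graph. -/
noncomputable def linkMids (C : (G.linkGraph U T).ConnectedComponent) : Finset V :=
  {v ∈ T | ∃ u ∈ G.linkVerts U T C, G.Adj v u}

/-- The components of the link graph that meet `U`. -/
noncomputable def linkComps : Finset (G.linkGraph U T).ConnectedComponent :=
  U.image (G.linkGraph U T).connectedComponentMk

variable {G U T} {C : (G.linkGraph U T).ConnectedComponent}

theorem mem_linkVerts {u : V} :
    u ∈ G.linkVerts U T C ↔ u ∈ U ∧ (G.linkGraph U T).connectedComponentMk u = C := by
  simp [linkVerts]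

theorem mem_linkMids {v : V} :
    v ∈ G.linkMids U T C ↔ v ∈ T ∧ ∃ u ∈ G.linkVerts U T C, G.Adj v u := by
  simp [linkMids]

/-- Links join only vertices of `U`, so a component that meets `U` stays inside it. -/
theorem coe_linkVerts (hC : C ∈ G.linkComps U T) : (G.linkVerts U T C : Set V) = C.supp := by
  ext w
  rw [Finset.mem_coe, mem_linkVerts, ConnectedComponent.mem_supp_iff, and_iff_right_iff_imp]
  intro hw
  obtain ⟨u, hu, huC⟩ := Finset.mem_image.1 hC
  obtain ⟨p⟩ := ConnectedComponent.exact (hw.trans huC.symm)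
  cases p with
  | nil => exact hu
  | cons h _ => exact h.2.1

theorem linkMids_subset : G.linkMids U T C ⊆ T := Finset.filter_subset _ _

theorem sum_linkVerts {N : Type*} [AddCommMonoid N] (f : V → N) :
    ∑ C ∈ G.linkComps U T, ∑ u ∈ G.linkVerts U T C, f u = ∑ u ∈ U, f u :=
  Finset.sum_fiberwise_of_maps_to (fun _ hu => Finset.mem_image_of_mem _ hu) f

theorem card_linkVerts (hC : C ∈ G.linkComps U T) : #(G.linkVerts U T C) = Nat.card C := by
  rw [← Set.ncard_coe_finset, coe_linkVerts hC]
  rfl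

variable (hTU : ∀ v ∈ T, ∀ u, G.Adj v u → u ∈ U)

include hTU in
theorem mem_linkVerts_of_mem_linkMids {v u : V} (hv : v ∈ G.linkMids U T C) (hu : G.Adj v u) :
    u ∈ G.linkVerts U T C := by
  obtain ⟨hvT, w, hw, hvw⟩ := mem_linkMids.1 hv
  rw [mem_linkVerts] at hw ⊢
  refine ⟨hTU v hvT u hu, ?_⟩
  by_cases huw : u = w
  · rw [huw, hw.2]
  · rw [← hw.2]
    exact ConnectedComponent.sound
      (Adj.reachable ⟨huw, hTU v hvT u hu, hw.1, v, hvT, hu, hvw⟩)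

variable [Fintype V] (hT : ∀ v ∈ T, G.degree v = 2)

include hT in
theorem neighborFinset_eq_pair {v a b : V} (hv : v ∈ T) (ha : G.Adj v a) (hb : G.Adj v b)
    (hab : a ≠ b) : G.neighborFinset v = {a, b} := by
  refine (Finset.eq_of_subset_of_card_le ?_ ?_).symm
  · simp [Finset.insert_subset_iff, ha, hb]
  · rw [card_neighborFinset_eq_degree, hT v hv, Finset.card_pair hab]

-- Send each link to a vertex of `T` that causes it. A vertex of degree 2 determines its pair of
-- neighbors, so the map is injective; several vertices of `T` may cause the same link.
include hT in
theorem card_edgeSet_toSimpleGraph_le (hC : C ∈ G.linkComps U T) :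
    Nat.card C.toSimpleGraph.edgeSet ≤ #(G.linkMids U T C) := by
  have hex : ∀ e : C.toSimpleGraph.edgeSet, ∃ v ∈ T, ∀ u ∈ e.1, G.Adj v u.1 := by
    rintro ⟨e, he⟩
    induction e using Sym2.ind with
    | _ a b =>
    obtain ⟨-, -, -, v, hv, hva, hvb⟩ := C.toSimpleGraph_hom.map_adj he
    refine ⟨v, hv, fun u hu => ?_⟩
    rcases Sym2.mem_iff.1 hu with rfl | rfl
    · exact hva
    · exact hvb
  choose f hfT hf using hex
  have hfm : ∀ e, f e ∈ G.linkMids U T C := by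
    intro e
    refine mem_linkMids.2 ⟨hfT e, (e.1.out.1 : V), ?_, hf e _ (Sym2.out_fst_mem _)⟩
    rw [← Finset.mem_coe, coe_linkVerts hC]
    exact e.1.out.1.2
  have hinj : Function.Injective f := by
    rintro ⟨e, he⟩ ⟨e', he'⟩ h
    have h1 := hf ⟨e, he⟩
    have h2 := hf ⟨e', he'⟩
    rw [← h] at h2
    have h3 := hfT ⟨e, he⟩
    rw [Subtype.mk.injEq]
    generalize f ⟨e, he⟩ = v at h1 h2 h3
    clear h
    induction e using Sym2.ind with
    | _ a b =>
    induction e' using Sym2.ind with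
    | _ a' b' =>
    have hab : a.1 ≠ b.1 := Subtype.coe_injective.ne ((mem_edgeSet _).1 he).ne
    have hab' : a'.1 ≠ b'.1 := Subtype.coe_injective.ne ((mem_edgeSet _).1 he').ne
    have := (neighborFinset_eq_pair hT h3 (h1 a (by simp)) (h1 b (by simp)) hab).symm.trans
      (neighborFinset_eq_pair hT h3 (h2 a' (by simp)) (h2 b' (by simp)) hab')
    have ha : a.1 ∈ ({a'.1, b'.1} : Finset V) := this ▸ by simp
    have hb : b.1 ∈ ({a'.1, b'.1} : Finset V) := this ▸ by simp
    simp only [Finset.mem_insert, Finset.mem_singleton, Subtype.coe_inj] at ha hb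
    rw [Ne, Subtype.coe_inj] at hab
    rw [Sym2.eq_iff]
    grind
  have := Nat.card_le_card_of_injective (fun e => (⟨f e, hfm e⟩ : G.linkMids U T C))
    fun e e' h => hinj (congrArg Subtype.val h)
  simpa using this

include hT in
theorem card_linkVerts_le (hC : C ∈ G.linkComps U T) :
    #(G.linkVerts U T C) ≤ #(G.linkMids U T C) + 1 := by
  rw [card_linkVerts hC]
  exact C.connected_toSimpleGraph.card_vert_le_card_edgeSet_add_one.trans
    (Nat.add_le_add_right (card_edgeSet_toSimpleGraph_le hT hC) 1)

include hT in
/-- A component of the link graph with as few linking vertices as possible is a tree, hence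
bipartite. -/
theorem exists_bipartition_of_card (hC : C ∈ G.linkComps U T)
    (h : #(G.linkMids U T C) + 1 = #(G.linkVerts U T C)) :
    ∃ b : V → Bool, ∀ u ∈ G.linkVerts U T C, ∀ w ∈ G.linkVerts U T C,
      (G.linkGraph U T).Adj u w → b u ≠ b w := by
  have htree : C.toSimpleGraph.IsTree := by
    refine isTree_iff_connected_and_card.2 ⟨C.connected_toSimpleGraph, le_antisymm ?_ ?_⟩
    · have h1 := card_edgeSet_toSimpleGraph_le hT hC
      have h2 := card_linkVerts hC
      refine le_of_le_of_eq ?_ h2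
      omega
    · exact C.connected_toSimpleGraph.card_vert_le_card_edgeSet_add_one
  obtain ⟨c⟩ := htree.colorable_two
  refine ⟨fun u => if hu : u ∈ C then decide (c ⟨u, hu⟩ = 0) else false, fun u hu w hw huw => ?_⟩
  have hu' : u ∈ C := by
    rw [← Finset.mem_coe, coe_linkVerts hC] at hu
    exact hu
  have hw' : w ∈ C := by
    rw [← Finset.mem_coe, coe_linkVerts hC] at hw
    exact hw
  have hne := c.valid ((C.toSimpleGraph_adj hu' hw').2 huw)
  simp only [hu', hw', dif_pos, ne_eq, decide_eq_decide]
  intro h'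
  omega

-- Double counting of the edges between the two sets: a linking vertex has two neighbors, both in
-- the same component.
include hTU hT in
theorem two_mul_card_linkMids :
    2 * #(G.linkMids U T C) = ∑ u ∈ G.linkVerts U T C, #{v ∈ T | G.Adj u v} := by
  have h1 : ∀ u ∈ G.linkVerts U T C,
      #{v ∈ T | G.Adj u v} = #(bipartiteAbove G.Adj (G.linkMids U T C) u) := by
    intro u hu
    congr 1
    ext v
    simp only [Finset.mem_filter, mem_bipartiteAbove, mem_linkMids]
    exact ⟨fun h => ⟨⟨h.1, u, hu, h.2.symm⟩, h.2⟩, fun h => ⟨h.1.1, h.2⟩⟩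
  rw [Finset.sum_congr rfl h1, Finset.sum_card_bipartiteAbove_eq_sum_card_bipartiteBelow,
    Finset.sum_const_nat (m := 2), mul_comm]
  intro v hv
  rw [← hT v (linkMids_subset hv), ← card_neighborFinset_eq_degree]
  congr 1
  ext u
  simp only [mem_bipartiteBelow, mem_neighborFinset]
  exact ⟨fun h => h.2.symm, fun h => ⟨mem_linkVerts_of_mem_linkMids hTU hv h, h.symm⟩⟩

include hTU hT in
theorem card_eq_sum_card_linkMids : #T = ∑ C ∈ G.linkComps U T, #(G.linkMids U T C) := by
  rw [← Finset.card_biUnion]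
  · congr 1
    ext v
    simp only [Finset.mem_biUnion, mem_linkMids]
    refine ⟨fun hv => ?_, fun ⟨_, _, h, _⟩ => h⟩
    obtain ⟨u, hu⟩ : (G.neighborFinset v).Nonempty := by
      rw [← Finset.card_pos, card_neighborFinset_eq_degree, hT v hv]
      norm_num
    rw [mem_neighborFinset] at hu
    exact ⟨_, Finset.mem_image_of_mem _ (hTU v hv u hu), hv, u,
      mem_linkVerts.2 ⟨hTU v hv u hu, rfl⟩, hu⟩
  · intro C _ C' _ hne
    rw [Function.onFun, Finset.disjoint_left]
    intro v hv hv'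
    obtain ⟨-, u, hu, hvu⟩ := mem_linkMids.1 hv
    exact hne ((mem_linkVerts.1 hu).2.symm.trans
      (mem_linkVerts.1 (mem_linkVerts_of_mem_linkMids hTU hv' hvu)).2)

end LinkGraph

/-! ### Private members by Hall's theorem -/

/-- If a family of finite sets has more than `D` times as many members as there are points, then
some nonempty subfamily assigns to each of its points `D` private members that contain it. -/
theorem exists_subfamily_with_private_members {ι X : Type*} [DecidableEq ι] [DecidableEq X]
    (N : ι → Finset X) (D : ℕ) (F : Finset ι) (hF : D * #(F.biUnion N) < #F) :
    ∃ F' ⊆ F, F'.Nonempty ∧ ∃ m : F'.biUnion N × Fin D → ι, Function.Injective m ∧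
      ∀ p, m p ∈ F' ∧ p.1.1 ∈ N (m p) := by
  induction hn : #F using Nat.strong_induction_on generalizing F with
  | _ n ih =>
  subst hn
  by_cases hmin : ∃ F' ⊂ F, D * #(F'.biUnion N) < #F'
  · obtain ⟨F', hss, hF'⟩ := hmin
    obtain ⟨F'', h1, h2⟩ := ih _ (Finset.card_lt_card hss) F' hF' rfl
    exact ⟨F'', h1.trans hss.1, h2⟩
  push Not at hmin
  refine ⟨F, Finset.Subset.refl _, Finset.card_pos.1 ((Nat.zero_le _).trans_lt hF), ?_⟩
  -- Hall's theorem with `D` copies of each point, for a minimal family. If the members `Z` that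
  -- meet a set `Y` of points numbered fewer than `D * #Y`, then `F \ Z` would still have more than
  -- `D` members per point, against minimality.
  obtain ⟨m, hm, hm'⟩ := (Finset.all_card_le_biUnion_card_iff_exists_injective
    fun p : F.biUnion N × Fin D => {i ∈ F | p.1.1 ∈ N i}).1 (by
    intro S
    rcases S.eq_empty_or_nonempty with rfl | hS
    · simp
    let Y : Finset X := S.image fun p => p.1.1
    have hSY : #S ≤ #Y * D := by
      have : #S ≤ #(Y ×ˢ (Finset.univ : Finset (Fin D))) := by
        refine Finset.card_le_card_of_injOn (fun p => (p.1.1, p.2)) ?_ ?_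
        · intro p hp
          simp only [Finset.coe_product, Set.mem_prod, Finset.mem_coe, Finset.mem_univ, and_true]
          exact Finset.mem_image_of_mem _ hp
        · rintro ⟨⟨x, hx⟩, j⟩ _ ⟨⟨y, hy⟩, j'⟩ _ h
          simpa using h
      simpa [Finset.card_product] using this
    have hYF : Y ⊆ F.biUnion N := by
      intro y hy
      obtain ⟨p, -, rfl⟩ := Finset.mem_image.1 hy
      exact p.1.2
    set Z : Finset ι := S.biUnion fun p => {i ∈ F | p.1.1 ∈ N i} with hZ
    have hZF : Z ⊆ F := by
      intro i hi
      simp only [hZ, Finset.mem_biUnion, Finset.mem_filter] at hi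
      obtain ⟨-, -, h, -⟩ := hi
      exact h
    have hZne : Z.Nonempty := by
      obtain ⟨p, hp⟩ := hS
      obtain ⟨i, hi, hpi⟩ := Finset.mem_biUnion.1 p.1.2
      exact ⟨i, Finset.mem_biUnion.2 ⟨p, hp, Finset.mem_filter.2 ⟨hi, hpi⟩⟩⟩
    have h1 := hmin (F \ Z) (Finset.sdiff_ssubset hZF hZne)
    have h2 : (F \ Z).biUnion N ⊆ F.biUnion N \ Y := by
      intro x hx
      obtain ⟨i, hi, hxi⟩ := Finset.mem_biUnion.1 hx
      rw [Finset.mem_sdiff] at hi ⊢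
      refine ⟨Finset.mem_biUnion.2 ⟨i, hi.1, hxi⟩, fun hxY => hi.2 ?_⟩
      obtain ⟨p, hp, rfl⟩ := Finset.mem_image.1 hxY
      exact Finset.mem_biUnion.2 ⟨p, hp, Finset.mem_filter.2 ⟨hi.1, hxi⟩⟩
    have h3 := Finset.card_le_card h2
    have h4 := Finset.card_sdiff_add_card_eq_card hZF
    have h5 := Finset.card_sdiff_add_card_eq_card hYF
    have h6 : D * #((F \ Z).biUnion N) ≤ D * #(F.biUnion N \ Y) := Nat.mul_le_mul_left _ h3
    have h7 : D * #(F.biUnion N) = D * #(F.biUnion N \ Y) + #Y * D := by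
      rw [← h5]
      ring
    omega)
  exact ⟨m, hm, fun p => by simpa using hm' p⟩

/-! ### Tight components are few -/

section Tight

open scoped Classical

variable {V α : Type*} [Fintype V] {G : SimpleGraph V} {L : V → Finset α} {U T : Finset V}
  {k M : ℕ} {q : V → V}

/-- A component of the link graph is tight if it has at most `D` vertices and no edges to spare. -/
def IsTightComponent (G : SimpleGraph V) (U T : Finset V) (M D : ℕ)
    (C : (G.linkGraph U T).ConnectedComponent) : Prop :=
  #(G.linkMids U T C) + 1 = #(G.linkVerts U T C) ∧ #(G.linkVerts U T C) ≤ D ∧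
    ∀ u ∈ G.linkVerts U T C, ∀ z, G.Adj u z → M ≤ G.degree z ∨ z ∈ T

/-- A minimal graph that is not colorable has few tight components. -/
theorem card_tightComponents_le (hdeg : ∀ v, G.degree v ≤ k) (hL : ∀ v, k ≤ #(L v))
    (hdel : ∀ R : Finset V, R.Nonempty → G.ListInjectivelyColorableOutside L R)
    (hnot : ¬ G.ListInjectivelyColorableOutside L ∅) (hM : 2 ≤ M) (hk : M * M + 1 ≤ k)
    (hT : ∀ v ∈ T, G.degree v = 2) (hTU : ∀ v ∈ T, ∀ u, G.Adj v u → u ∈ U)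
    (hU : ∀ u ∈ U, G.degree u < M) (hqU : ∀ u ∈ U, G.Adj u (q u))
    (hqM : ∀ u ∈ U, M ≤ G.degree (q u))
    (hq : ∀ u ∈ U, ∀ z, G.Adj u z → M ≤ G.degree z → z = q u) (D : ℕ) :
    #{C ∈ G.linkComps U T | G.IsTightComponent U T M D C} ≤
      D * #{x : V | M ≤ G.degree x} := by
  by_contra! hlt
  let N : (G.linkGraph U T).ConnectedComponent → Finset V :=
    fun C => (G.linkVerts U T C).image q
  have hNB : ({C ∈ G.linkComps U T | G.IsTightComponent U T M D C}).biUnion N ⊆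
      ({x : V | M ≤ G.degree x} : Finset V) := by
    intro x hx
    obtain ⟨C, -, hxC⟩ := Finset.mem_biUnion.1 hx
    obtain ⟨u, hu, rfl⟩ := Finset.mem_image.1 hxC
    simpa using hqM u (mem_linkVerts.1 hu).1
  obtain ⟨F, hFsub, hFne, m, hm, hmF⟩ := exists_subfamily_with_private_members N D _
    ((Nat.mul_le_mul_left D (Finset.card_le_card hNB)).trans_lt hlt)
  have hFc : ∀ C ∈ F, C ∈ G.linkComps U T := fun C hC => (Finset.mem_filter.1 (hFsub hC)).1
  have hFt : ∀ C ∈ F, G.IsTightComponent U T M D C :=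
    fun C hC => (Finset.mem_filter.1 (hFsub hC)).2
  -- By injectivity of `m`, a component is private to at most one big vertex, so its two sides can
  -- be named such that a vertex attached to that big vertex is on the side `true`.
  have hside : ∀ C : (G.linkGraph U T).ConnectedComponent, ∃ b : V → Bool, C ∈ F →
      (∀ u ∈ G.linkVerts U T C, ∀ w ∈ G.linkVerts U T C,
        (G.linkGraph U T).Adj u w → b u ≠ b w) ∧
      ∀ p, m p = C → ∃ u ∈ G.linkVerts U T C, q u = p.1.1 ∧ b u = true := by
    intro C
    by_cases hC : C ∈ F
    · obtain ⟨b, hb⟩ := exists_bipartition_of_card hT (hFc C hC) (hFt C hC).1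
      by_cases hp : ∃ p, m p = C
      · obtain ⟨p, rfl⟩ := hp
        obtain ⟨u, hu, hup⟩ := Finset.mem_image.1 (hmF p).2
        refine ⟨fun w => b w == b u, fun _ => ⟨fun v hv w hw h => ?_, fun p' hp' => ?_⟩⟩
        · have := hb v hv w hw h
          change (b v == b u) ≠ (b w == b u)
          revert this
          generalize b v = x
          generalize b w = y
          generalize b u = t
          revert x y t
          decide
        · rw [hm hp']
          exact ⟨u, hu, hup, by simp⟩
      · exact ⟨b, fun _ => ⟨hb, fun p h => absurd ⟨p, h⟩ hp⟩⟩
    · exact ⟨fun _ => true, fun h => absurd h hC⟩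
  choose β hβ using hside
  let P : Finset V := F.biUnion (G.linkVerts U T)
  let R : Finset V := F.biUnion (G.linkMids U T)
  let b : V → Prop := fun v => β ((G.linkGraph U T).connectedComponentMk v) v = true
  have hP : ∀ u, u ∈ P ↔ u ∈ U ∧ (G.linkGraph U T).connectedComponentMk u ∈ F := by
    intro u
    simp only [P, Finset.mem_biUnion, mem_linkVerts]
    exact ⟨fun ⟨C, hC, hu, h⟩ => ⟨hu, h ▸ hC⟩, fun ⟨hu, h⟩ => ⟨_, h, hu, rfl⟩⟩
  have hPV : ∀ u ∈ P, u ∈ G.linkVerts U T ((G.linkGraph U T).connectedComponentMk u) :=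
    fun u hu => mem_linkVerts.2 ⟨((hP u).1 hu).1, rfl⟩
  have hPadj : ∀ u w, (G.linkGraph U T).Adj u w →
      (G.linkGraph U T).connectedComponentMk w = (G.linkGraph U T).connectedComponentMk u :=
    fun u w h => ConnectedComponent.sound h.symm.reachable
  have hRT : R ⊆ T := by
    intro v hv
    obtain ⟨C, -, hvC⟩ := Finset.mem_biUnion.1 hv
    exact linkMids_subset hvC
  have hRP : ∀ v ∈ R, ∀ u, G.Adj v u → u ∈ P := by
    intro v hv u hvu
    obtain ⟨C, hC, hvC⟩ := Finset.mem_biUnion.1 hv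
    exact Finset.mem_biUnion.2 ⟨C, hC, mem_linkVerts_of_mem_linkMids hTU hvC hvu⟩
  have hUR : ∀ u ∈ P, u ∉ R := by
    intro u hu huR
    have huU := ((hP u).1 hu).1
    exact absurd (hU _ (hTU u (hRT huR) _ (hqU u huU))) (hqM u huU).not_gt
  obtain ⟨C₀, hC₀⟩ := hFne
  obtain ⟨u₀, hu₀, rfl⟩ := Finset.mem_image.1 (hFc C₀ hC₀)
  have hα : Nonempty α := by
    obtain ⟨a, -⟩ := Finset.card_pos.1 (lt_of_lt_of_le (by omega : 0 < k) (hL u₀))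
    exact ⟨a⟩
  -- Without linking vertices, tightness would leave `u₀` with `q u₀` as its only neighbor.
  have hR : R.Nonempty := by
    have hu₀P := (hP u₀).2 ⟨hu₀, hC₀⟩
    have h2 := two_le_degree_of_not_colorable hdeg hL hdel hnot (by omega) u₀
    by_contra hR
    have h1 : G.neighborFinset u₀ ⊆ {q u₀} := by
      intro z hz
      rw [mem_neighborFinset] at hz
      rw [Finset.mem_singleton]
      rcases (hFt _ ((hP u₀).1 hu₀P).2).2.2 u₀ (hPV u₀ hu₀P) z hz with h | h
      · exact hq u₀ hu₀ z hz h
      · exact absurd ⟨z, Finset.mem_biUnion.2 ⟨_, ((hP u₀).1 hu₀P).2,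
          mem_linkMids.2 ⟨h, u₀, hPV u₀ hu₀P, hz.symm⟩⟩⟩ hR
    have h3 := Finset.card_le_card h1
    rw [card_neighborFinset_eq_degree, Finset.card_singleton] at h3
    omega
  obtain ⟨c, hc, hc'⟩ := hdel R hR
  obtain ⟨c₁, hc₁, hc₁'⟩ := exists_list_coloring_of_cliques P q (G.linkGraph U T).Adj b
    (by
      intro u hu w hw huw
      have h1 := (hβ _ ((hP u).1 hu).2).1 u (hPV u hu) w
        (by rw [← hPadj u w huw]; exact hPV w hw) huw
      simp only [b, hPadj u w huw]
      revert h1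
      cases β ((G.linkGraph U T).connectedComponentMk u) u <;>
        cases β ((G.linkGraph U T).connectedComponentMk u) w <;> simp)
    (fun u w h => h.symm) D
    (by
      intro u hu
      refine (Finset.card_le_card fun w hw => ?_).trans (hFt _ ((hP u).1 hu).2).2.1
      rw [Finset.mem_filter] at hw
      rw [← hPadj u w hw.2]
      exact hPV w hw.1)
    (by
      intro u hu
      have hqu : q u ∈ F.biUnion N := Finset.mem_biUnion.2
        ⟨_, ((hP u).1 hu).2, Finset.mem_image_of_mem _ (hPV u hu)⟩
      -- Each of the `D` private components of `q u` contributes a vertex of side `b` to the clique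
      -- of `u`.
      have hex : ∀ j : Fin D, ∃ w ∈ G.linkVerts U T (m (⟨q u, hqu⟩, j)),
          q w = q u ∧ β (m (⟨q u, hqu⟩, j)) w = true :=
        fun j => (hβ _ (hmF (⟨q u, hqu⟩, j)).1).2 _ rfl
      choose f hf hfq hfβ using hex
      have := Finset.card_le_card_of_injOn (s := Finset.univ)
        (t := {w ∈ P | q u = q w ∧ b w}) f (by
          intro j _
          have h := mem_linkVerts.1 (hf j)
          rw [Finset.mem_coe, Finset.mem_filter, hP]
          refine ⟨⟨h.1, ?_⟩, (hfq j).symm, ?_⟩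
          · rw [h.2]
            exact (hmF _).1
          · simp only [b]
            rw [h.2]
            exact hfβ j) (by
          intro j _ j' _ h
          have h1 := (mem_linkVerts.1 (hf j)).2
          rw [h, (mem_linkVerts.1 (hf j')).2] at h1
          simpa using (hm h1).symm)
      simpa using this)
    -- Colors of neighbors of `q u` outside `P` are excluded. As `q u` has at most `k` neighbors, at
    -- least as many colors remain as the clique of `u` has vertices.
    (fun u => L u \ (G.neighborFinset (q u) \ P).image c)
    (by
      intro u hu
      have huU := ((hP u).1 hu).1
      have h1 := Finset.le_card_sdiff ((G.neighborFinset (q u) \ P).image c) (L u)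
      have h2 : #((G.neighborFinset (q u) \ P).image c) ≤ #(G.neighborFinset (q u) \ P) :=
        Finset.card_image_le
      have h3 := Finset.card_sdiff_add_card_inter (G.neighborFinset (q u)) P
      have h4 : #{w ∈ P | q u = q w} ≤ #(G.neighborFinset (q u) ∩ P) := by
        refine Finset.card_le_card fun w hw => ?_
        rw [Finset.mem_filter] at hw
        rw [Finset.mem_inter, mem_neighborFinset, hw.2]
        exact ⟨(hqU w ((hP w).1 hw.1).1).symm, hw.1⟩
      rw [card_neighborFinset_eq_degree] at h3
      have := hdeg (q u)
      have := hL u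
      omega)
  -- By tightness, a common neighbor of `u` and `w` is `q u` or a vertex of `T`: the first is
  -- handled by cliques and reduced lists, the second by links.
  have key : ∀ u ∈ P, ∀ w ∉ R, ∀ z, G.Adj z u → G.Adj z w → u ≠ w →
      c₁ u ≠ if w ∈ P then c₁ w else c w := by
    intro u hu w hw z hzu hzw hne
    have huU := ((hP u).1 hu).1
    rcases (hFt _ ((hP u).1 hu).2).2.2 u (hPV u hu) z hzu.symm with hz | hz
    · have hzq := hq u huU z hzu.symm hz
      by_cases hwP : w ∈ P
      · rw [if_pos hwP]
        refine hc₁' u hu w hwP hne (.inl ?_)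
        rw [← hzq]
        exact hq w ((hP w).1 hwP).1 z hzw.symm hz
      · rw [if_neg hwP]
        intro h
        refine (Finset.mem_sdiff.1 (hc₁ u hu)).2 ?_
        rw [h, ← hzq]
        exact Finset.mem_image_of_mem _ (Finset.mem_sdiff.2 ⟨by simpa using hzw, hwP⟩)
    · have hwU := hTU z hz w hzw
      have hadj : (G.linkGraph U T).Adj u w := ⟨hne, huU, hwU, z, hz, hzu, hzw⟩
      have hwP : w ∈ P := by
        rw [hP, hPadj u w hadj]
        exact ⟨hwU, ((hP u).1 hu).2⟩
      rw [if_pos hwP]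
      exact hc₁' u hu w hwP hne (.inr hadj)
  refine hnot (listInjectivelyColorableOutside_empty.2 (exists_extend_list_coloring
    G.conflictGraph L Rᶜ (fun v => if v ∈ P then c₁ v else c v) ?_ ?_ ?_))
  · intro u hu
    rw [Finset.mem_compl] at hu
    by_cases huP : u ∈ P
    · simpa [huP] using (Finset.mem_sdiff.1 (hc₁ u huP)).1
    · simpa [huP] using hc u hu
  · rintro u hu w hw ⟨hne, z, hzu, hzw⟩
    rw [Finset.mem_compl] at hu hw
    by_cases huP : u ∈ P
    · simpa [huP] using key u huP w hw z hzu hzw hne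
    · by_cases hwP : w ∈ P
      · simpa [huP, hwP, eq_comm] using key w hwP u hu z hzw hzu hne.symm
      · simpa [huP, hwP] using hc' z (fun hz => huP (hRP z hz u hzu)) u hu w hw hzu hzw hne
  · intro v hv
    rw [Finset.mem_compl, not_not] at hv
    exact degree_conflictGraph_lt_of_small hk (hL v) (by rw [hT v (hRT hv)]; exact hM)
      fun u hu => hU u (hTU v (hRT hv) u hu)

end Tight

/-! ### Discharging -/

section Discharging

open scoped Classical

variable {V α : Type*} [Fintype V] {G : SimpleGraph V} {L : V → Finset α} {U T : Finset V}
  {k M D : ℕ} {q : V → V} {ε : ℝ}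

/-- Only tight components of the link graph lack charge, and at most one unit. -/
theorem neg_ite_le_charge_component (hε : 0 < ε) (hD : 2 ≤ ε * D)
    (hT : ∀ v ∈ T, G.degree v = 2) (hTU : ∀ v ∈ T, ∀ u, G.Adj v u → u ∈ U)
    (hqU : ∀ u ∈ U, G.Adj u (q u)) (hqM : ∀ u ∈ U, M ≤ G.degree (q u)) (hqT : ∀ u ∈ U, q u ∉ T)
    {C : (G.linkGraph U T).ConnectedComponent} (hC : C ∈ G.linkComps U T) :
    (-(if G.IsTightComponent U T M D C then 1 else 0) : ℝ) ≤
      ∑ u ∈ G.linkVerts U T C, ((G.degree u : ℝ) - 2 + ε / 2) -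
        (1 - ε) * #(G.linkMids U T C) := by
  have hsub : ∀ u ∈ U, insert (q u) {v ∈ T | G.Adj u v} ⊆ G.neighborFinset u := by
    intro u hu v hv
    rw [mem_neighborFinset]
    rcases Finset.mem_insert.1 hv with rfl | hv
    · exact hqU u hu
    · exact (Finset.mem_filter.1 hv).2
  have hcard : ∀ u ∈ U, #(insert (q u) {v ∈ T | G.Adj u v}) = #{v ∈ T | G.Adj u v} + 1 :=
    fun u hu => Finset.card_insert_of_notMem fun h => hqT u hu (Finset.mem_filter.1 h).1
  have hle : ∀ u ∈ G.linkVerts U T C, #{v ∈ T | G.Adj u v} + 1 ≤ G.degree u := by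
    intro u hu
    have huU := (mem_linkVerts.1 hu).1
    rw [← hcard u huU, ← card_neighborFinset_eq_degree]
    exact Finset.card_le_card (hsub u huU)
  have hsum := Finset.sum_le_sum hle
  rw [Finset.sum_add_distrib, ← two_mul_card_linkMids hTU hT, Finset.sum_const, smul_eq_mul,
    mul_one] at hsum
  have ht := card_linkVerts_le hT hC
  have hval : ∑ u ∈ G.linkVerts U T C, ((G.degree u : ℝ) - 2 + ε / 2) -
      (1 - ε) * #(G.linkMids U T C) =
      ((∑ u ∈ G.linkVerts U T C, G.degree u : ℕ) : ℝ) - 2 * #(G.linkVerts U T C) -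
        #(G.linkMids U T C) + ε / 2 * #(G.linkVerts U T C) + ε * #(G.linkMids U T C) := by
    rw [Finset.sum_add_distrib, Finset.sum_sub_distrib]
    push_cast
    simp only [Finset.sum_const, nsmul_eq_mul]
    ring
  rw [hval]
  have hsum' : 2 * (#(G.linkMids U T C) : ℝ) + #(G.linkVerts U T C) ≤
      ((∑ u ∈ G.linkVerts U T C, G.degree u : ℕ) : ℝ) := by exact_mod_cast hsum
  have ht' : (#(G.linkVerts U T C) : ℝ) ≤ #(G.linkMids U T C) + 1 := by exact_mod_cast ht
  have hεt : 0 ≤ ε / 2 * #(G.linkVerts U T C) := by positivity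
  have hεe : 0 ≤ ε * #(G.linkMids U T C) := by positivity
  -- Let `t` be the number of vertices, `e` of linking vertices. The degree sum is at least `2e + t`
  -- and `t ≤ e + 1`, so the charge is at least `e - t ≥ -1`. There is no deficit if `e ≥ t`, if the
  -- degree sum exceeds `2e + t`, or if `t > D`, since `ε / 2 * D ≥ 1`; otherwise the component is
  -- tight.
  by_cases htight : G.IsTightComponent U T M D C
  · rw [if_pos htight]
    linarith
  · rw [if_neg htight]
    by_cases h1 : #(G.linkVerts U T C) ≤ #(G.linkMids U T C)
    · have : (#(G.linkVerts U T C) : ℝ) ≤ #(G.linkMids U T C) := by exact_mod_cast h1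
      linarith
    by_cases h2 : 2 * #(G.linkMids U T C) + #(G.linkVerts U T C) + 1 ≤
        ∑ u ∈ G.linkVerts U T C, G.degree u
    · have : 2 * (#(G.linkMids U T C) : ℝ) + #(G.linkVerts U T C) + 1 ≤
        ((∑ u ∈ G.linkVerts U T C, G.degree u : ℕ) : ℝ) := by exact_mod_cast h2
      linarith
    have heq : ∀ u ∈ G.linkVerts U T C, #{v ∈ T | G.Adj u v} + 1 = G.degree u := by
      refine (Finset.sum_eq_sum_iff_of_le hle).1 ?_
      rw [Finset.sum_add_distrib, ← two_mul_card_linkMids hTU hT, Finset.sum_const, smul_eq_mul,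
        mul_one]
      omega
    have h3 : D < #(G.linkVerts U T C) := by
      by_contra! h3
      refine htight ⟨by omega, h3, fun u hu z hz => ?_⟩
      have huU := (mem_linkVerts.1 hu).1
      have h4 := Finset.eq_of_subset_of_card_le (hsub u huU)
        (by rw [card_neighborFinset_eq_degree, hcard u huU, heq u hu])
      rw [← mem_neighborFinset, ← h4, Finset.mem_insert, Finset.mem_filter] at hz
      rcases hz with rfl | hz
      · exact .inl (hqM u huU)
      · exact .inr hz.1
    have h4 : (D : ℝ) ≤ #(G.linkVerts U T C) := by exact_mod_cast h3.le
    have h5 := mul_le_mul_of_nonneg_left h4 hε.le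
    linarith

/-- A minimal graph that is not colorable is not sparse. -/
theorem colorable_of_sparse_of_deletions (hdeg : ∀ v, G.degree v ≤ k) (hL : ∀ v, k ≤ #(L v))
    (hdel : ∀ R : Finset V, R.Nonempty → G.ListInjectivelyColorableOutside L R)
    (hε : 0 < ε) (hε1 : ε ≤ 1) (hD : 2 ≤ ε * D) (hM : 2 * (D + 3) ≤ ε * M) (hk : M * M + 1 ≤ k)
    (hsparse : ((∑ v, G.degree v : ℕ) : ℝ) < (3 - ε) * Fintype.card V) :
    G.ListInjectivelyColorableOutside L ∅ := by
  by_contra hnot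
  have hM3 : 3 ≤ M := by
    have h1 : ε * M ≤ 1 * M := mul_le_mul_of_nonneg_right hε1 (Nat.cast_nonneg _)
    have h2 : (0 : ℝ) ≤ D := Nat.cast_nonneg _
    have h3 : (3 : ℝ) ≤ M := by linarith
    exact_mod_cast h3
  have hdeg2 := two_le_degree_of_not_colorable hdeg hL hdel hnot (by omega)
  let B : Finset V := {x | M ≤ G.degree x}
  have hB : ∀ x, x ∈ B ↔ M ≤ G.degree x := fun x => by simp [B]
  let b : V → ℕ := fun v => #{x ∈ B | G.Adj v x}
  let W : Finset V := {v | G.degree v = 2 ∧ b v = 0}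
  let U : Finset V := {v | v ∉ B ∧ b v = 1}
  let T : Finset V := {v ∈ W | ∀ u, G.Adj v u → u ∈ U}
  have hW : ∀ v, v ∈ W ↔ G.degree v = 2 ∧ b v = 0 := fun v => by simp [W]
  have hUm : ∀ v, v ∈ U ↔ v ∉ B ∧ b v = 1 := fun v => by simp [U]
  have hTm : ∀ v, v ∈ T ↔ v ∈ W ∧ ∀ u, G.Adj v u → u ∈ U := fun v => by simp [T]
  have hb0 : ∀ v, b v = 0 → ∀ u, G.Adj v u → u ∉ B := by
    intro v hv u hvu hu
    have : u ∈ ({x ∈ B | G.Adj v x} : Finset V) := Finset.mem_filter.2 ⟨hu, hvu⟩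
    rw [Finset.card_eq_zero.1 hv] at this
    simp at this
  have hWB : ∀ v ∈ W, v ∉ B := by
    intro v hv
    rw [hB, ((hW v).1 hv).1]
    omega
  have hTW : T ⊆ W := Finset.filter_subset _ _
  have hT : ∀ v ∈ T, G.degree v = 2 := fun v hv => ((hW v).1 (hTW hv)).1
  have hTU : ∀ v ∈ T, ∀ u, G.Adj v u → u ∈ U := fun v hv => ((hTm v).1 hv).2
  have hU : ∀ u ∈ U, G.degree u < M := fun u hu => by
    have := ((hUm u).1 hu).1
    rw [hB] at this
    omega
  have hqex : ∀ u, ∃ x, u ∈ U → ({x ∈ B | G.Adj u x} : Finset V) = {x} := by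
    intro u
    by_cases hu : u ∈ U
    · obtain ⟨x, hx⟩ := Finset.card_eq_one.1 ((hUm u).1 hu).2
      exact ⟨x, fun _ => hx⟩
    · exact ⟨u, fun h => absurd h hu⟩
  choose q hqs using hqex
  have hqmem : ∀ u ∈ U, q u ∈ B ∧ G.Adj u (q u) := fun u hu => by
    have : q u ∈ ({q u} : Finset V) := by simp
    rwa [← hqs u hu, Finset.mem_filter] at this
  have hq : ∀ u ∈ U, ∀ z, G.Adj u z → M ≤ G.degree z → z = q u := by
    intro u hu z hz hzM
    rw [← Finset.mem_singleton, ← hqs u hu, Finset.mem_filter, hB]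
    exact ⟨hzM, hz⟩
  have hqM : ∀ u ∈ U, M ≤ G.degree (q u) := fun u hu => (hB _).1 (hqmem u hu).1
  have htight : #{C ∈ G.linkComps U T | G.IsTightComponent U T M D C} ≤ D * #B :=
    card_tightComponents_le hdeg hL hdel hnot (by omega) hk hT hTU hU
      (fun u hu => (hqmem u hu).2) hqM hq D
  have hcomp : -(#{C ∈ G.linkComps U T | G.IsTightComponent U T M D C} : ℝ) ≤
      ∑ u ∈ U, ((G.degree u : ℝ) - 2 + ε / 2) - (1 - ε) * #T := by
    have h := Finset.sum_le_sum fun C hC => neg_ite_le_charge_component hε hD hT hTU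
      (fun u hu => (hqmem u hu).2) hqM (fun u hu h => hWB _ (hTW h) (hqmem u hu).1) (C := C) hC
    rw [Finset.sum_neg_distrib, Finset.sum_boole, Finset.sum_sub_distrib, ← Finset.mul_sum,
      sum_linkVerts, ← Nat.cast_sum, ← card_eq_sum_card_linkMids hTU hT] at h
    exact h
  -- A vertex of `W \ T` has a neighbor outside `U`; this neighbor sees a big vertex, hence at least
  -- two, and can afford to give one unit.
  have hWT : #(W \ T) ≤ ∑ v ∈ ({v ∈ Bᶜ | 2 ≤ b v} : Finset V), #{w ∈ W \ T | G.Adj v w} := by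
    have h := Finset.sum_card_bipartiteAbove_eq_sum_card_bipartiteBelow G.Adj
      (s := ({v ∈ Bᶜ | 2 ≤ b v} : Finset V)) (t := W \ T)
    refine le_of_le_of_eq ?_ h.symm
    rw [Finset.card_eq_sum_ones]
    refine Finset.sum_le_sum fun w hw => ?_
    rw [Finset.mem_sdiff, hTm] at hw
    obtain ⟨hwW, hw⟩ := hw
    push Not at hw
    obtain ⟨u, hwu, huU⟩ := hw hwW
    have hwN : ∀ u, G.Adj w u → u ∉ B := hb0 w ((hW w).1 hwW).2
    obtain ⟨x, hux, hx⟩ := exists_big_neighbor_of_not_colorable hL hdel hnot (by omega) hk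
      ((hW w).1 hwW).1 (fun u hu => by
        have := hwN u hu
        rw [hB] at this
        omega) hwu
    have hbu : 0 < b u := Finset.card_pos.2 ⟨x, Finset.mem_filter.2 ⟨(hB x).2 hx, hux⟩⟩
    have hbu1 : b u ≠ 1 := fun h => huU ((hUm u).2 ⟨hwN u hwu, h⟩)
    refine Finset.card_pos.2 ⟨u, ?_⟩
    rw [mem_bipartiteBelow, Finset.mem_filter, Finset.mem_compl]
    exact ⟨⟨hwN u hwu, by omega⟩, hwu.symm⟩
  have hbig : ∑ v ∈ Bᶜ, b v ≤ ∑ x ∈ B, G.degree x := by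
    have h := Finset.sum_card_bipartiteAbove_eq_sum_card_bipartiteBelow G.Adj (s := Bᶜ) (t := B)
    refine le_of_eq_of_le h (Finset.sum_le_sum fun x _ => ?_)
    rw [← card_neighborFinset_eq_degree]
    refine Finset.card_le_card fun v hv => ?_
    rw [mem_bipartiteBelow] at hv
    simpa using hv.2.symm
  -- The right side is the charge of a small vertex after the big ones have given `1 - ε / 2` to
  -- each neighbor. The left side sorts it: `U` and `T` are settled by components, and vertices with
  -- two big neighbors pay for `W \ T`.
  have hpoint : ∀ v ∈ Bᶜ, (if v ∈ U then (G.degree v : ℝ) - 2 + ε / 2 else 0) +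
      (if v ∈ T then -(1 - ε) else 0) + (if v ∈ W \ T then -1 else 0) +
      (if 2 ≤ b v then (#{w ∈ W \ T | G.Adj v w} : ℝ) else 0) ≤
      (G.degree v : ℝ) - 3 + ε + (1 - ε / 2) * b v := by
    intro v hv
    rw [Finset.mem_compl] at hv
    rcases Nat.lt_or_ge (b v) 1 with h0 | h0
    · have hbv : b v = 0 := by omega
      have hvU : v ∉ U := fun h => by
        have := ((hUm v).1 h).2
        omega
      rw [if_neg hvU, if_neg (by omega : ¬ 2 ≤ b v), hbv]
      by_cases hvW : v ∈ W
      · have hd : (G.degree v : ℝ) = 2 := by exact_mod_cast ((hW v).1 hvW).1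
        by_cases hvT : v ∈ T
        · rw [if_pos hvT, if_neg (by simp [hvT]), hd]
          norm_num
        · rw [if_neg hvT, if_pos (by simp [hvT, hvW]), hd]
          norm_num
          linarith
      · rw [if_neg fun h => hvW (hTW h), if_neg (by simp [hvW])]
        have hd : G.degree v ≠ 2 := fun h => hvW ((hW v).2 ⟨h, hbv⟩)
        have hd3 : 3 ≤ G.degree v := by
          have := hdeg2 v
          omega
        have hd3' : (3 : ℝ) ≤ G.degree v := by exact_mod_cast hd3
        norm_num
        linarith
    have hvW : v ∉ W := fun h => by
      have := ((hW v).1 h).2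
      omega
    rw [if_neg fun h => hvW (hTW h), if_neg (by simp [hvW] : v ∉ W \ T)]
    rcases Nat.lt_or_ge (b v) 2 with h1 | h1
    · have hbv : b v = 1 := by omega
      rw [if_pos ((hUm v).2 ⟨hv, hbv⟩), if_neg (by omega), hbv]
      norm_num
      linarith
    · have hvU : v ∉ U := fun h => by
        have := ((hUm v).1 h).2
        omega
      rw [if_neg hvU, if_pos h1]
      have hle : #{w ∈ W \ T | G.Adj v w} + b v ≤ G.degree v := by
        rw [← card_neighborFinset_eq_degree, ← Finset.card_union_of_disjoint]
        · refine Finset.card_le_card fun w hw => ?_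
          rw [mem_neighborFinset]
          rcases Finset.mem_union.1 hw with h | h
          · exact (Finset.mem_filter.1 h).2
          · exact (Finset.mem_filter.1 h).2
        · rw [Finset.disjoint_left]
          intro w hw hw'
          exact hWB w (Finset.mem_sdiff.1 (Finset.mem_filter.1 hw).1).1 (Finset.mem_filter.1 hw').1
      have hle' : (#{w ∈ W \ T | G.Adj v w} : ℝ) + b v ≤ G.degree v := by exact_mod_cast hle
      have hb2 : (2 : ℝ) ≤ b v := by exact_mod_cast h1
      -- What is left after paying is at least `(2 - ε / 2) * b v - 3 + ε`, which is at least 1 when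
      -- `b v ≥ 2`.
      nlinarith
  have hsmall : -(D * #B : ℝ) ≤ ∑ v ∈ Bᶜ, ((G.degree v : ℝ) - 3 + ε + (1 - ε / 2) * b v) := by
    refine le_trans ?_ (Finset.sum_le_sum hpoint)
    rw [Finset.sum_add_distrib, Finset.sum_add_distrib, Finset.sum_add_distrib,
      ← Finset.sum_filter, ← Finset.sum_filter, ← Finset.sum_filter, ← Finset.sum_filter]
    have e1 : ({v ∈ Bᶜ | v ∈ U} : Finset V) = U := by
      ext v
      rw [Finset.mem_filter, Finset.mem_compl, hUm]
      tauto
    have e2 : ({v ∈ Bᶜ | v ∈ T} : Finset V) = T := by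
      ext v
      rw [Finset.mem_filter, Finset.mem_compl, and_iff_right_iff_imp]
      exact fun h => hWB v (hTW h)
    have e3 : ({v ∈ Bᶜ | v ∈ W \ T} : Finset V) = W \ T := by
      ext v
      rw [Finset.mem_filter, Finset.mem_compl, and_iff_right_iff_imp]
      exact fun h => hWB v (Finset.mem_sdiff.1 h).1
    rw [e1, e2, e3, Finset.sum_const, Finset.sum_const, nsmul_eq_mul, nsmul_eq_mul]
    have h1 : (#{C ∈ G.linkComps U T | G.IsTightComponent U T M D C} : ℝ) ≤ D * #B := by
      exact_mod_cast htight
    have h2 : (#(W \ T) : ℝ) ≤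
        ∑ v ∈ ({v ∈ Bᶜ | 2 ≤ b v} : Finset V), (#{w ∈ W \ T | G.Adj v w} : ℝ) := by
      exact_mod_cast hWT
    linarith
  -- A big vertex of degree `d` keeps `ε * d / 2 - 3 + ε`, which is at least `D` by the choice of
  -- `M`.
  have hlarge : (D * #B : ℝ) + (1 - ε / 2) * ∑ v ∈ Bᶜ, (b v : ℝ) ≤
      ∑ x ∈ B, ((G.degree x : ℝ) - 3 + ε) := by
    have h1 : ∀ x ∈ B, (D : ℝ) + (1 - ε / 2) * G.degree x ≤ (G.degree x : ℝ) - 3 + ε := by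
      intro x hx
      have h2 : (M : ℝ) ≤ G.degree x := by exact_mod_cast (hB x).1 hx
      have h3 := mul_le_mul_of_nonneg_left h2 hε.le
      linarith
    refine le_trans ?_ (Finset.sum_le_sum h1)
    rw [Finset.sum_add_distrib, Finset.sum_const, nsmul_eq_mul, ← Finset.mul_sum, mul_comm (D : ℝ)]
    have h4 : ∑ v ∈ Bᶜ, (b v : ℝ) ≤ ∑ x ∈ B, (G.degree x : ℝ) := by exact_mod_cast hbig
    have h5 := mul_le_mul_of_nonneg_left h4 (by linarith : 0 ≤ 1 - ε / 2)
    linarith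
  have htotal : ∑ v, ((G.degree v : ℝ) - 3 + ε) < 0 := by
    rw [Finset.sum_add_distrib, Finset.sum_sub_distrib, Finset.sum_const, Finset.sum_const,
      nsmul_eq_mul, nsmul_eq_mul, Finset.card_univ]
    push_cast at hsparse
    linarith
  rw [← Finset.sum_add_sum_compl B] at htotal
  rw [Finset.sum_add_distrib, ← Finset.mul_sum] at hsmall
  linarith

end Discharging

/-! ### Induction over induced subgraphs and conclusion -/

open scoped Classical in
/-- Sparse graphs whose degrees are at most `k` can be colored injectively from lists of size `k`,
if `k` is large enough. -/
theorem exists_list_injective_coloring_of_sparse {α : Type*} {ε : ℝ} {k M D : ℕ} (hε : 0 < ε)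
    (hε1 : ε ≤ 1) (hD : 2 ≤ ε * D) (hM : 2 * (D + 3) ≤ ε * M) (hk : M * M + 1 ≤ k)
    {V : Type*} [Fintype V] (G : SimpleGraph V) (hdeg : ∀ v, G.degree v ≤ k)
    (hsparse : ∀ S : Finset V, S.Nonempty →
      ((∑ v ∈ S, #{w ∈ S | G.Adj v w} : ℕ) : ℝ) < (3 - ε) * #S)
    (L : V → Finset α) (hL : ∀ v, k ≤ #(L v)) :
    ∃ c : V → α, (∀ v, c v ∈ L v) ∧ G.IsInjectiveColoring c := by
  -- Here `S` is the set of vertices kept. The number `k` stays fixed although the maximum degree of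
  -- an induced subgraph may drop.
  suffices H : ∀ S : Finset V, G.ListInjectivelyColorableOutside L Sᶜ by
    obtain ⟨c, hc, hc'⟩ := listInjectivelyColorableOutside_empty.1 (by simpa using H Finset.univ)
    exact ⟨c, hc, isInjectiveColoring_iff.2 hc'⟩
  intro S
  induction hn : #S using Nat.strong_induction_on generalizing S with
  | _ n ih =>
  subst hn
  rcases S.eq_empty_or_nonempty with rfl | hS
  · by_cases hV : Nonempty V
    · obtain ⟨v⟩ := hV
      obtain ⟨a, -⟩ := Finset.card_pos.1 (lt_of_lt_of_le (by omega : 0 < k) (hL v))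
      exact ⟨fun _ => a, by simp⟩
    · exact ⟨fun v => absurd ⟨v⟩ hV, fun v => absurd ⟨v⟩ hV, fun v => absurd ⟨v⟩ hV⟩
  let G' : SimpleGraph S := G.induce (S : Set V)
  have hG' : ∀ v : S, G'.degree v = #{w ∈ S | G.Adj v w} := by
    intro v
    rw [← card_neighborFinset_eq_degree, ← Finset.card_map (Function.Embedding.subtype _)]
    congr 1
    ext w
    simp [G', and_comm]
  have hdel : ∀ R : Finset S, R.Nonempty →
      G'.ListInjectivelyColorableOutside (fun v => L v) R := by
    intro R hR
    let S' : Finset V := S \ R.map (Function.Embedding.subtype _)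
    have hS' : ∀ v : S, v ∉ R → v.1 ∉ S'ᶜ := by
      intro v hv
      simp [S', hv]
    have hlt : #S' < #S := by
      refine Finset.card_lt_card (Finset.sdiff_ssubset ?_ (by simpa using hR))
      intro v hv
      obtain ⟨w, -, rfl⟩ := Finset.mem_map.1 hv
      exact w.2
    obtain ⟨c, hc, hc'⟩ := ih _ hlt S' rfl
    exact ⟨fun v => c v, fun v hv => hc v (hS' v hv), fun z hz u hu w hw hzu hzw hne =>
      hc' z (hS' z hz) u (hS' u hu) w (hS' w hw) hzu hzw (Subtype.coe_injective.ne hne)⟩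
  obtain ⟨c, hc, hc'⟩ := listInjectivelyColorableOutside_empty.1
    (colorable_of_sparse_of_deletions (G := G') (L := fun v => L v) (k := k) (fun v => by
      refine le_trans (le_of_eq (by convert hG' v)) ?_
      refine le_trans (Finset.card_le_card fun w hw => ?_)
        ((card_neighborFinset_eq_degree G v.1).le.trans (hdeg v))
      simpa using (Finset.mem_filter.1 hw).2) (fun v => hL v) hdel hε hε1 hD hM hk (by
      have h := hsparse S hS
      rw [← Finset.sum_coe_sort, ← Finset.sum_congr rfl fun v _ => hG' v] at h
      convert h
      exact Fintype.card_coe S))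
  have hex : Nonempty α := by
    obtain ⟨v, hv⟩ := hS
    exact ⟨c ⟨v, hv⟩⟩
  refine ⟨fun v => if hv : v ∈ S then c ⟨v, hv⟩ else Classical.arbitrary α, ?_, ?_⟩
  · intro v hv
    rw [Finset.mem_compl, not_not] at hv
    simpa [hv] using hc ⟨v, hv⟩
  · intro z hz u hu w hw hzu hzw hne
    rw [Finset.mem_compl, not_not] at hz hu hw
    simp only [hu, hw, dif_pos]
    exact hc' ⟨u, hu⟩ ⟨w, hw⟩ ⟨by simpa using hne, ⟨z, hz⟩, hzu, hzw⟩

theorem listInjectiveChromaticNumber_eq_maxDegree {V : Type*} [Fintype V] {G : SimpleGraph V}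
    [DecidableRel G.Adj] (h : G.ListInjectivelyColorable G.maxDegree) :
    G.listInjectiveChromaticNumber = (G.maxDegree : ℕ∞) :=
  le_antisymm (iInf₂_le _ h) (le_iInf₂ fun _ hk => by
    exact_mod_cast maxDegree_le_of_listInjectivelyColorable hk)

/-- A maximum degree that suffices for graphs of maximum average degree less than `3 - ε`. -/
noncomputable def degreeThreshold (ε : ℝ) : ℕ :=
  -- This is `M * M + 1` with `D = ⌈2 / ε⌉₊` and `M = ⌈2 * (D + 3) / ε⌉₊`.
  ⌈2 * (⌈2 / ε⌉₊ + 3) / ε⌉₊ * ⌈2 * (⌈2 / ε⌉₊ + 3) / ε⌉₊ + 1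

theorem listInjectivelyColorable_of_maxAverageDegree_lt {ε : ℝ} (hε : 0 < ε) (hε1 : ε ≤ 1)
    {V : Type*} [Fintype V] {G : SimpleGraph V} [DecidableRel G.Adj]
    (h : G.maxAverageDegree < 3 - ε) (hG : degreeThreshold ε ≤ G.maxDegree) :
    G.ListInjectivelyColorable G.maxDegree := by
  classical
  intro α L hL
  refine exists_list_injective_coloring_of_sparse hε hε1 (D := ⌈2 / ε⌉₊)
    (M := ⌈2 * (⌈2 / ε⌉₊ + 3) / ε⌉₊) ?_ ?_ hG G (fun v => ?_)
    (fun S hS => ?_) L (fun v => (hL v).ge)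
  · rw [← div_le_iff₀' hε]
    exact Nat.le_ceil _
  · rw [← div_le_iff₀' hε]
    exact Nat.le_ceil _
  · convert G.degree_le_maxDegree v
  · convert sum_card_adj_lt_of_maxAverageDegree_lt h hS

end SimpleGraph

open SimpleGraph in
theorem theorem2 :
    (∃ f : ℝ → ℝ, ∀ ε : ℝ, 0 < ε →
      ∀ (V : Type*) [Fintype V] (G : SimpleGraph V) [DecidableRel G.Adj],
        G.maxAverageDegree < 3 - ε → f ε ≤ (G.maxDegree : ℝ) →
          G.listInjectiveChromaticNumber = (G.maxDegree : ℕ∞)) ∧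
    (∀ n : ℕ, ∃ (V : Type) (_ : Fintype V) (G : SimpleGraph V) (_ : DecidableRel G.Adj),
      G.maxAverageDegree < 3 ∧ n ≤ G.maxDegree ∧ ¬ G.InjectivelyColorable G.maxDegree) := by
  classical
  -- Discharging needs `ε ≤ 1`; for larger `ε` the hypothesis on `mad` only becomes stronger.
  refine ⟨⟨fun ε => degreeThreshold (min ε 1), fun ε hε V _ G _ h hG => ?_⟩, fun n => ?_⟩
  · exact listInjectiveChromaticNumber_eq_maxDegree
      (listInjectivelyColorable_of_maxAverageDegree_lt (lt_min hε one_pos) (min_le_right _ _)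
        (h.trans_le (sub_le_sub_left (min_le_left _ _) _)) (Nat.cast_le.1 hG))
  · refine ⟨_, inferInstance, hubGraph (n + 1), Classical.decRel _,
      hubGraph_maxAverageDegree_lt, ?_⟩
    rw [hubGraph_maxDegree (by omega)]
    exact ⟨by omega, hubGraph_not_injectivelyColorable⟩
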